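/- Call a relation $R\subseteq\{0,1\}^*\times\{0,1\}^*$ \emph{polynomially bounded} if there is a polynomial $q$ with $|y|\le q(|x|)$ for all $(x,y)\in R$. For a kind of algorithm, $\mathsf{FP}$ (deterministic polynomial time), $\mathsf{FBPP}$ (randomized polynomial time) or $\mathsf{FBQP}$ (quantum polynomial time), the relational classes with advice are defined as follows. The class with randomized advice ($\mathsf{FP/rpoly}$, $\mathsf{FBPP/rpoly}$, $\mathsf{FBQP/rpoly}$) consists of all polynomially bounded relations $R$ for which there are an algorithm $A$ of that kind, a polynomial $p(n,m)$, and probability distributions $\mathcal D_{n,m}$ on $\{0,1\}^{p(n,m)}$, such that for every $x$ for which some $y$ has $(x,y)\in R$, and for every integer $m\ge 1$, with $n=|x|$, $$\Pr\big[(x,A(x,0^m,w))\in R\big]\ \ge\ 1-\frac1m ,$$ where the probability is over $w\sim\mathcal D_{n,m}$ and the independent internal randomness of $A$ (if any). The class with deterministic advice ($\mathsf{FBPP/poly}$, $\mathsf{FBQP/poly}$) is defined in the same way, with a fixed advice string $a_{n,m}\in\{0,1\}^{p(n,m)}$ in place of $w\sim\mathcal D_{n,m}$. Here a randomized polynomial-time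 algorithm is a deterministic polynomial-time algorithm that is given, in addition to its input, a uniformly random string whose length is a polynomial in the input length. A quantum polynomial-time algorithm computes, in deterministic polynomial time from its input, the description of a quantum circuit over the universal gate set $\{H,T,\mathrm{CNOT}\}$, runs that circuit on $|0\cdots0\rangle$, measures all qubits in the computational basis, and computes its output in deterministic polynomial time from the input and the measured bits. \textbf{Theorem.} $$\mathsf{FBPP/rpoly}=\mathsf{FBPP/poly}=\mathsf{FP/rpoly}\qquad\text{and}\qquad \mathsf{FBQP/rpoly}=\mathsf{FBQP/poly}.$$ -/

import Mathlib

noncomputable section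

namespace RelAdvice

/-! ### Polynomial-time computation on tuples of binary strings -/

/-- A tuple of binary strings as one string over the alphabet `{0, 1, #}`:
`w₁ # w₂ # ⋯ w_k #`, where the separator `#` is `none`. -/
def encodeStrings (L : List (List Bool)) : List (Option Bool) :=
  L.flatMap fun w => w.map some ++ [none]

/-- `f` is computable by a deterministic multi-stack Turing machine in time polynomial in the
length of its input, where inputs and outputs are presented as tuples of binary strings. -/
def PolyTime {α β : Type} (ea : α → List (List Bool)) (eb : β → List (List Bool))
    (f : α → β) : Prop :=
  Nonempty (Turing.TM2ComputableInPolyTime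
    (fun a => encodeStrings (ea a)) (fun b => encodeStrings (eb b)) f)

/-- The instance `(x, 0^m, a)`: input `x`, error parameter `m` in unary, advice string `a`. -/
structure Instance where
  x : List Bool
  m : ℕ
  a : List Bool

namespace Instance

/-- The three strings `x`, `0^m`, `a`. -/
def strings (z : Instance) : List (List Bool) :=
  [z.x, List.replicate z.m false, z.a]

/-- The total length of `x`, `0^m` and `a`. -/
def size (z : Instance) : ℕ := z.x.length + z.m + z.a.length

end Instance

/-! ### Quantum circuits over the universal gate set `{H, T, CNOT}` -/

/-- A gate acting on `N` qubits. -/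
inductive Gate (N : ℕ) where
  | hadamard (i : Fin N)
  | phaseT (i : Fin N)
  | cnot (c t : Fin N) (hct : c ≠ t)

/-- Flip the `i`-th bit. -/
def flipBit {N : ℕ} (i : Fin N) (b : Fin N → Bool) : Fin N → Bool :=
  Function.update b i (!b i)

/-- Action of a gate on a vector of amplitudes, indexed by the computational basis. -/
def Gate.apply {N : ℕ} : Gate N → ((Fin N → Bool) → ℂ) → ((Fin N → Bool) → ℂ)
  | .hadamard i, ψ => fun b =>
      ((Real.sqrt 2 : ℝ) : ℂ)⁻¹ * (ψ (flipBit i b) + (if b i then -1 else 1) * ψ b)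
  | .phaseT i, ψ => fun b =>
      (if b i then Complex.exp (((Real.pi / 4 : ℝ) : ℂ) * Complex.I) else 1) * ψ b
  | .cnot c t _, ψ => fun b => ψ (if b c then flipBit t b else b)

/-- A quantum circuit: a number of qubits and a list of gates, the first of which acts first. -/
structure Circuit where
  N : ℕ
  gates : List (Gate N)

/-- Unary notation for a natural number. -/
def unary (n : ℕ) : List Bool := List.replicate n true

/-- Description of a gate: a tag for its type, then the qubits it acts on. -/
def Gate.strings {N : ℕ} : Gate N → List (List Bool)
  | .hadamard i => [unary 0, unary i]
  | .phaseT i => [unary 1, unary i]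
  | .cnot c t _ => [unary 2, unary c, unary t]

namespace Circuit

/-- Description of a circuit: the number of qubits, then the gates in order. -/
def strings (C : Circuit) : List (List Bool) :=
  unary C.N :: C.gates.flatMap Gate.strings

/-- The state that the circuit produces from the basis state `|0⋯0⟩`. -/
def finalState (C : Circuit) : (Fin C.N → Bool) → ℂ :=
  C.gates.foldl (fun ψ g => g.apply ψ) (Pi.single (fun _ => false) 1)

end Circuit

lemma flipBit_flipBit {N : ℕ} (i : Fin N) (b : Fin N → Bool) :
    flipBit i (flipBit i b) = b := by
  simp [flipBit]

lemma sum_flipBit {N : ℕ} (i : Fin N) (F : (Fin N → Bool) → ℝ) :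
    ∑ b, F (flipBit i b) = ∑ b, F b :=
  Equiv.sum_comp (Function.Involutive.toPerm (flipBit i) (flipBit_flipBit i)) F

/-- Every gate preserves the norm. -/
lemma Gate.sum_normSq_apply {N : ℕ} (g : Gate N) (ψ : (Fin N → Bool) → ℂ) :
    ∑ b, Complex.normSq (g.apply ψ b) = ∑ b, Complex.normSq (ψ b) := by
  cases g with
  | hadamard i =>
    have key : ∀ b, Complex.normSq ((Gate.hadamard i).apply ψ b)
        + Complex.normSq ((Gate.hadamard i).apply ψ (flipBit i b))
        = Complex.normSq (ψ b) + Complex.normSq (ψ (flipBit i b)) := by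
      intro b
      have h2 : Complex.normSq (((Real.sqrt 2 : ℝ) : ℂ)⁻¹) = 1 / 2 := by
        rw [map_inv₀, Complex.normSq_ofReal, Real.mul_self_sqrt (by norm_num)]
        norm_num
      have hf : flipBit i b i = !b i := by simp [flipBit]
      simp only [Gate.apply, flipBit_flipBit, hf, map_mul, h2]
      cases b i <;> simp [Complex.normSq_apply] <;> ring
    have hs := Finset.sum_congr (rfl : (Finset.univ : Finset (Fin N → Bool)) = Finset.univ)
      (fun b _ => key b)
    rw [Finset.sum_add_distrib, Finset.sum_add_distrib,
      sum_flipBit i (fun b => Complex.normSq ((Gate.hadamard i).apply ψ b)),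
      sum_flipBit i (fun b => Complex.normSq (ψ b))] at hs
    linarith
  | phaseT i =>
    refine Finset.sum_congr rfl fun b _ => ?_
    simp only [Gate.apply, map_mul]
    split_ifs
    · rw [Complex.normSq_eq_norm_sq, Complex.norm_exp_ofReal_mul_I]
      simp
    · simp
  | cnot c t hct =>
    have hinv : Function.Involutive
        (fun b : Fin N → Bool => if b c then flipBit t b else b) := by
      intro b
      by_cases h : b c
      · have h' : flipBit t b c = true := by simp [flipBit, Function.update_of_ne hct, h]
        simp [h, h', flipBit_flipBit]
      · simp [h]
    exact Equiv.sum_comp hinv.toPerm (fun b => Complex.normSq (ψ b))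

lemma Circuit.sum_normSq_finalState (C : Circuit) :
    ∑ b, Complex.normSq (C.finalState b) = 1 := by
  have h : ∀ (l : List (Gate C.N)) (ψ : (Fin C.N → Bool) → ℂ),
      ∑ b, Complex.normSq (l.foldl (fun ψ g => g.apply ψ) ψ b) = ∑ b, Complex.normSq (ψ b) := by
    intro l
    induction l with
    | nil => intro ψ; rfl
    | cons g l ih => intro ψ; rw [List.foldl_cons, ih, Gate.sum_normSq_apply]
  rw [Circuit.finalState, h, Finset.sum_eq_single (fun _ => false)]
  · simp
  · intro b _ hb; simp [Pi.single_eq_of_ne hb]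
  · simp

/-- The outcome of measuring all qubits of the final state in the computational basis. -/
def Circuit.outcome (C : Circuit) : PMF (Fin C.N → Bool) :=
  PMF.ofFintype (fun b => ENNReal.ofReal (Complex.normSq (C.finalState b))) (by
    rw [← ENNReal.ofReal_sum_of_nonneg (fun b _ => Complex.normSq_nonneg _),
      C.sum_normSq_finalState, ENNReal.ofReal_one])

/-! ### Polynomial-time algorithms, identified by their output distributions on `(x, 0^m, a)` -/

/-- The output distribution of an algorithm on each instance. -/
abbrev Behaviour := Instance → PMF (List Bool)

/-- Deterministic polynomial-time algorithms. -/
def Deterministic (S : Behaviour) : Prop :=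
  ∃ A : Instance → List Bool,
    PolyTime Instance.strings (fun y => [y]) A ∧
    ∀ z, S z = PMF.pure (A z)

/-- Randomized polynomial-time algorithms: a deterministic polynomial-time algorithm gets
polynomially many uniformly random bits `r` as a further argument. -/
def Randomized (S : Behaviour) : Prop :=
  ∃ (A : Instance × List Bool → List Bool) (q : Polynomial ℕ),
    PolyTime (fun zr => zr.1.strings ++ [zr.2]) (fun y => [y]) A ∧
    ∀ z, S z = (PMF.uniformOfFintype (List.Vector Bool (q.eval z.size))).map
      fun r => A (z, r.toList)

/-- Quantum polynomial-time algorithms: a deterministic polynomial-time algorithm writes down a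
quantum circuit for the instance; the circuit is run on `|0⋯0⟩` and all its qubits are measured;
a deterministic polynomial-time algorithm computes the output from the instance and the
measured bits. -/
def Quantum (S : Behaviour) : Prop :=
  ∃ (Q : Instance → Circuit) (A : Instance × List Bool → List Bool),
    PolyTime Instance.strings Circuit.strings Q ∧
    PolyTime (fun zb => zb.1.strings ++ [zb.2]) (fun y => [y]) A ∧
    ∀ z, S z = (Q z).outcome.map fun b => A (z, List.ofFn b)

/-! ### Relational complexity classes with advice -/

/-- A relational problem `R ⊆ {0,1}* × {0,1}*`. -/
abbrev Relation := Set (List Bool × List Bool)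

/-- `|y| ≤ p(|x|)` for all `(x, y) ∈ R`, for some polynomial `p`. -/
def PolyBounded (R : Relation) : Prop :=
  ∃ p : Polynomial ℕ, ∀ x y, (x, y) ∈ R → y.length ≤ p.eval x.length

/-- The probability of the event `E` under the distribution `μ`. -/
def prob {α : Type} (μ : PMF α) (E : Set α) : ℝ := (μ.toOuterMeasure E).toReal

/-- The value `p(n, m)` of a polynomial in two variables. -/
def evalPoly (p : MvPolynomial (Fin 2) ℕ) (n m : ℕ) : ℕ := MvPolynomial.eval ![n, m] p

/-- The relational class of a kind of algorithm with deterministic advice `a_{n,m}` of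
`p(n,m)` bits. -/
def withPoly (alg : Behaviour → Prop) : Set Relation :=
  {R | PolyBounded R ∧ ∃ (S : Behaviour) (p : MvPolynomial (Fin 2) ℕ)
    (a : ∀ n m : ℕ, List.Vector Bool (evalPoly p n m)),
    alg S ∧ ∀ x, (∃ y, (x, y) ∈ R) → ∀ m : ℕ, 1 ≤ m →
      1 - 1 / (m : ℝ) ≤ prob (S ⟨x, m, (a x.length m).toList⟩) {y | (x, y) ∈ R}}

/-- The relational class of a kind of algorithm with randomized advice, drawn (independently of
the algorithm's own randomness) from a distribution `D_{n,m}` on strings of `p(n,m)` bits. -/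
def withRPoly (alg : Behaviour → Prop) : Set Relation :=
  {R | PolyBounded R ∧ ∃ (S : Behaviour) (p : MvPolynomial (Fin 2) ℕ)
    (D : ∀ n m : ℕ, PMF (List.Vector Bool (evalPoly p n m))),
    alg S ∧ ∀ x, (∃ y, (x, y) ∈ R) → ∀ m : ℕ, 1 ≤ m →
      1 - 1 / (m : ℝ) ≤
        prob ((D x.length m).bind fun w => S ⟨x, m, w.toList⟩) {y | (x, y) ∈ R}}

/-- `FP/rpoly` -/
def FP_rpoly : Set Relation := withRPoly Deterministic

/-- `FBPP/poly` -/
def FBPP_poly : Set Relation := withPoly Randomized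

/-- `FBPP/rpoly` -/
def FBPP_rpoly : Set Relation := withRPoly Randomized

/-- `FBQP/poly` -/
def FBQP_poly : Set Relation := withPoly Quantum

/-- `FBQP/rpoly` -/
def FBQP_rpoly : Set Relation := withRPoly Quantum

end RelAdvice

end

/-!
Deterministic advice is a special case of randomized advice, and randomized advice can carry the
random bits of a randomized algorithm (`FBPP_rpoly_subset_FP_rpoly`). What remains is to replace
randomized advice by deterministic advice when the algorithm has randomness of its own, for
relations, where the outputs of several runs cannot be combined into a better one: it may be
impossible to recognize a correct output.

The idea is to write polynomially many samples of the randomized advice into the deterministic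
advice and to let the algorithm choose one of them uniformly. For the error `1 / m`, take samples of
the advice for error `1 / (4 * m)`, and `2 ^ l ≥ 2 * m * n` of them, numbered by tags of `l` bits.
For each sequence of samples, add up `2 ^ (∑ t, fail x (w t))` over all inputs `x` of length `n`,
where `fail x w` is the failure probability on `x` with advice `w`. As `2 ^ f ≤ 1 + f` for
`0 ≤ f ≤ 1`, some sequence makes this sum at most `2 ^ n * (1 + ε) ^ (2 ^ l)` with
`ε = 1 / (4 * m)`, and so the average failure is at most `n / 2 ^ l + 2 * ε ≤ 1 / m` for all `x` at
once (`exists_samples`). This gives the inclusion for every kind of algorithm that can be averaged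
over polynomially many advice strings (`Averageable`, `withRPoly_subset_withPoly`).

A randomized algorithm is averaged by spending some random bits on the tag
(`averageable_randomized`). A quantum algorithm has to fix its circuit before anything is measured,
and its randomness comes only from the final measurement. The new circuit
therefore runs the circuits for all samples in parallel, on disjoint sets of qubits, besides a
register of `l` qubits with a Hadamard gate on each; the tag measured there selects the block of
measured bits from which the output is computed. The final state is a product state, so that the
tag is uniform and independent of the blocks (`prob_parallel`), and the output is distributed as it
should be (`prob_parallelCircuit`, `averageable_quantum`).

That these constructions run in polynomial time is shown with multi-stack Turing machines.
Flowcharts that may call such machines as subroutines are compiled to machines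
(`polyTime_of_flow`), which gives closure under composition, concatenation and iteration over the
strings of a tuple (`PolyTime.comp`, `PolyTime.append`, `PolyTime.flatMap`). All else is composed of
finite transducers (`Transducer.polyTime`, `Transducer.polyTime_register`). The advice holds a
header, with the number of random bits or the qubits for the tag, and one block per tag, with the
parameters of the original algorithm and the position of the bits to be used.
-/

noncomputable section

namespace RelAdvice

open Turing Function

/-! ### Flowcharts with oracle calls -/

/-- The alphabet of encoded tuples of strings: two bits, and the separator `none`. -/
abbrev Sym := Option Bool

/-- Control point of a flowchart: a node to be executed, an oracle call, or the end. -/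
inductive Ctrl (ι L : Type)
  | goto (l : L)
  | call (i : ι)
  | halt

/-- Storage of a flowchart: registers, and for each oracle an input and an output stack. -/
abbrev Port (R ι : Type) := R ⊕ (ι ⊕ ι)

/-- The storage that a flowchart may push on: registers and oracle inputs. -/
def Port.push {R ι : Type} : R ⊕ ι → Port R ι
  | .inl r => .inl r
  | .inr i => .inr (.inl i)

/-- The storage that a flowchart may pop from: registers and oracle outputs. -/
def Port.pop {R ι : Type} : R ⊕ ι → Port R ι
  | .inl r => .inl r
  | .inr i => .inr (.inr i)

/-- A flowchart with stack registers and oracles. Each node pops one symbol from a register or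
from the output of an oracle; depending on the result, it pushes symbols on registers and oracle
inputs, and moves on. The call of oracle `i` returns to the node `ret i`. -/
structure Flow (R L ι : Type) where
  start : L
  src : R
  dst : R
  ret : ι → L
  pop : L → R ⊕ ι
  act : L → Option Sym → List ((R ⊕ ι) × Sym) × Ctrl ι L

namespace Flow

variable {R L ι : Type} [DecidableEq R] [DecidableEq ι] (F : Flow R L ι)

/-- The contents of the storage of a flowchart. -/
abbrev State (R ι : Type) := Port R ι → List Sym

/-- Push symbols one after another. -/
def pushAll (S : State R ι) (xs : List ((R ⊕ ι) × Sym)) : State R ι :=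
  xs.foldl (fun S x => update S (Port.push x.1) (x.2 :: S (Port.push x.1))) S

/-- `F.Run O c S t c' S'`: the flowchart gets from `(c, S)` to `(c', S')` in time `t`, where
`O i u v t` says that oracle `i` answers `u` by `v` in time `t`. An oracle whose input is not empty
may not be popped from, because the input and output stacks of a Turing machine may be the same;
for the same reason its output has to be empty when it is called. -/
inductive Run (O : ι → List Sym → List Sym → ℕ → Prop) :
    Ctrl ι L → State R ι → ℕ → Ctrl ι L → State R ι → Prop
  | refl (c S) : Run O c S 0 c S
  | node (l S t c T) :
      (∀ i, F.pop l = .inr i → S (.inr (.inl i)) = []) →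
      Run O (F.act l (S (Port.pop (F.pop l))).head?).2
        (pushAll (update S (Port.pop (F.pop l)) (S (Port.pop (F.pop l))).tail)
          (F.act l (S (Port.pop (F.pop l))).head?).1) t c T →
      Run O (.goto l) S (t + 1) c T
  | call (i S v t₀ t c T) :
      O i (S (.inr (.inl i))) v t₀ → S (.inr (.inr i)) = [] →
      Run O (.goto (F.ret i)) (update (update S (.inr (.inl i)) []) (.inr (.inr i)) v) t c T →
      Run O (.call i) S (t + t₀) c T

/-! ### Compilation of flowcharts to Turing machines -/

variable (M : ι → TM2ComputableAux Sym Sym)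

variable (R) in
/-- The stacks of the compiled machine. -/
abbrev K := R ⊕ (Σ i, (M i).tm.K)

variable (R) in
/-- The stack alphabets of the compiled machine. -/
abbrev Γ : K R M → Type
  | .inl _ => Sym
  | .inr x => (M x.1).tm.Γ x.2

variable (L) in
/-- The labels of the compiled machine. -/
abbrev Λ := L ⊕ (Σ i, (M i).tm.Λ)

/-- The internal state of the compiled machine: the symbol just popped, and the internal states
of the oracle machines. -/
abbrev σ := Option Sym × (∀ i, (M i).tm.σ)

variable (R L) in
/-- The statements of the compiled machine. -/
abbrev BStmt := TM2.Stmt (Γ R M) (Λ L M) (σ M)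

/-- The internal state at every control point of the flowchart. -/
def initσ : σ M := (none, fun i => (M i).tm.initialState)

/-- A statement of oracle machine `i` as a statement of the compiled machine. Halting becomes the
return to the flowchart. -/
def trStmt (i : ι) : TM2.Stmt (M i).tm.Γ (M i).tm.Λ (M i).tm.σ → BStmt R L M
  | .push k f q => .push (Sum.inr ⟨i, k⟩) (fun v => f (v.2 i)) (trStmt i q)
  | .peek k f q =>
    .peek (Sum.inr ⟨i, k⟩) (fun v o => (v.1, update v.2 i (f (v.2 i) o))) (trStmt i q)
  | .pop k f q =>
    .pop (Sum.inr ⟨i, k⟩) (fun v o => (v.1, update v.2 i (f (v.2 i) o))) (trStmt i q)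
  | .load f q => .load (fun v => (v.1, update v.2 i (f (v.2 i)))) (trStmt i q)
  | .branch f q₁ q₂ => .branch (fun v => f (v.2 i)) (trStmt i q₁) (trStmt i q₂)
  | .goto f => .goto fun v => Sum.inr ⟨i, f (v.2 i)⟩
  | .halt => .goto fun _ => Sum.inl (F.ret i)

/-- The control point as a label of the compiled machine. -/
def ctrlLabel : Ctrl ι L → Option (Λ L M)
  | .goto l => some (.inl l)
  | .call i => some (.inr ⟨i, (M i).tm.main⟩)
  | .halt => none

/-- Move on to a control point. -/
def ctrlStmt : Ctrl ι L → BStmt R L M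
  | .goto l => .goto fun _ => .inl l
  | .call i => .goto fun _ => .inr ⟨i, (M i).tm.main⟩
  | .halt => .halt

/-- Push a symbol, then execute `q`. -/
def pushStmt (q : BStmt R L M) : (R ⊕ ι) × Sym → BStmt R L M
  | (.inl r, s) => .push (Sum.inl r) (fun _ => s) q
  | (.inr i, s) => .push (Sum.inr ⟨i, (M i).tm.k₀⟩) (fun _ => (M i).inputAlphabet.symm s) q

/-- Push the given symbols and move on. The popped symbol is forgotten first, so that the internal
state is `initσ` again. -/
def actStmt (a : List ((R ⊕ ι) × Sym) × Ctrl ι L) : BStmt R L M :=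
  .load (fun v => (none, v.2)) (a.1.foldr (fun x q => pushStmt M q x) (ctrlStmt M a.2))

/-- Act according to the popped symbol. -/
def caseStmt (act : Option Sym → List ((R ⊕ ι) × Sym) × Ctrl ι L) : BStmt R L M :=
  .branch (fun v => v.1 == none) (actStmt M (act none)) <|
  .branch (fun v => v.1 == some none) (actStmt M (act (some none))) <|
  .branch (fun v => v.1 == some (some true)) (actStmt M (act (some (some true))))
    (actStmt M (act (some (some false))))

/-- The statement for a node that pops from `p` and acts by `act`. -/
def nodeStmt (p : R ⊕ ι) (act : Option Sym → List ((R ⊕ ι) × Sym) × Ctrl ι L) :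
    BStmt R L M :=
  match p with
  | .inl r => .pop (Sum.inl r) (fun v o => (o, v.2)) (caseStmt M act)
  | .inr i => .pop (Sum.inr ⟨i, (M i).tm.k₁⟩)
      (fun v o => (o.map (M i).outputAlphabet, v.2)) (caseStmt M act)

/-- The program of the compiled machine. -/
def prog : Λ L M → BStmt R L M
  | .inl l => nodeStmt M (F.pop l) (F.act l)
  | .inr x => F.trStmt M x.1 ((M x.1).tm.m x.2)

variable {F M}

/-- Stack contents of the compiled machine, from those of registers and of oracle machines. -/
def stks (SR : R → List Sym) (G : ∀ i k, List ((M i).tm.Γ k)) : ∀ k, List (Γ R M k)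
  | .inl r => SR r
  | .inr x => G x.1 x.2

theorem update_stks_inl (SR : R → List Sym) (G : ∀ i k, List ((M i).tm.Γ k)) (r s) :
    update (stks SR G) (Sum.inl r) s = stks (update SR r s) G := by
  funext k
  rcases k with r' | x
  · by_cases h : r' = r
    · subst h; simp [stks]
    · rw [update_of_ne (by simpa using h)]; simp [stks, h]
  · rw [update_of_ne (by simp)]; rfl

theorem update_stks_inr (SR : R → List Sym) (G : ∀ i k, List ((M i).tm.Γ k)) (i k)
    (s : List ((M i).tm.Γ k)) :
    update (stks SR G) (Sum.inr ⟨i, k⟩) s = stks SR (update G i (update (G i) k s)) := by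
  funext k'
  rcases k' with r' | ⟨j, k'⟩
  · rw [update_of_ne (by simp)]; rfl
  · by_cases h : j = i
    · subst h
      by_cases h' : k' = k
      · subst h'; simp [stks]
      · rw [update_of_ne (by simpa using h')]; simp [stks, h']
    · rw [update_of_ne (by simp [h])]; simp [stks, h]

variable (F) in
/-- The label of an oracle machine as a label of the compiled machine. -/
def trLabel (i : ι) : Option (M i).tm.Λ → Option (Λ L M)
  | some l => some (.inr ⟨i, l⟩)
  | none => some (.inl (F.ret i))

variable (F) in
/-- The configuration of the compiled machine while oracle machine `i` is in configuration `c`. -/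
def trCfg (i : ι) (v : σ M) (SR : R → List Sym) (G : ∀ i k, List ((M i).tm.Γ k))
    (c : TM2.Cfg (M i).tm.Γ (M i).tm.Λ (M i).tm.σ) : TM2.Cfg (Γ R M) (Λ L M) (σ M) :=
  ⟨F.trLabel i c.l, (v.1, update v.2 i c.var), stks SR (update G i c.stk)⟩

theorem stepAux_trStmt (i : ι) (q : TM2.Stmt (M i).tm.Γ (M i).tm.Λ (M i).tm.σ) (v : σ M)
    (SR : R → List Sym) (G : ∀ i k, List ((M i).tm.Γ k)) :
    TM2.stepAux (F.trStmt M i q) v (stks SR G)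
      = F.trCfg i v SR G (TM2.stepAux q (v.2 i) (G i)) := by
  have ups : ∀ k s, update (stks SR G) (Sum.inr ⟨i, k⟩ : K R M) s
      = stks SR (update G i (update (G i) k s)) := update_stks_inr SR G i
  induction q generalizing v G with
  | push k f q ih =>
    simp only [trStmt, TM2.stepAux]
    rw [ups, ih _ _ (update_stks_inr _ _ i)]
    simp [trCfg, stks]
  | peek k f q ih =>
    simp only [trStmt, TM2.stepAux]
    rw [ih _ _ ups]
    simp [trCfg, stks]
  | pop k f q ih =>
    simp only [trStmt, TM2.stepAux]
    rw [ups, ih _ _ (update_stks_inr _ _ i)]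
    simp [trCfg, stks]
  | load f q ih =>
    simp only [trStmt, TM2.stepAux]
    rw [ih _ _ ups]
    simp [trCfg]
  | branch f q₁ q₂ ih₁ ih₂ =>
    simp only [trStmt, TM2.stepAux]
    rw [ih₁ _ _ ups, ih₂ _ _ ups]
    cases f (v.2 i) <;> rfl
  | goto f => simp [trStmt, TM2.stepAux, trCfg, trLabel]
  | halt => simp [trStmt, TM2.stepAux, trCfg, trLabel]

theorem iterate_bind_none {α : Type*} (f : α → Option α) (n : ℕ) :
    (flip bind f)^[n] (none : Option α) = none :=
  Function.iterate_fixed rfl n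

/-- The compiled machine simulates the oracle machines step by step. -/
theorem iterate_trCfg (i : ι) (v : σ M) (SR : R → List Sym) (G : ∀ i k, List ((M i).tm.Γ k))
    (n : ℕ) (c c' : TM2.Cfg (M i).tm.Γ (M i).tm.Λ (M i).tm.σ)
    (h : (flip bind (TM2.step (M i).tm.m))^[n] (some c) = some c') :
    (flip bind (TM2.step (F.prog M)))^[n] (some (F.trCfg i v SR G c))
      = some (F.trCfg i v SR G c') := by
  induction n generalizing c with
  | zero => simp only [iterate_zero, id_eq, Option.some.injEq] at h ⊢; rw [h]
  | succ n ih =>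
    rw [iterate_succ_apply] at h ⊢
    obtain ⟨l, w, T⟩ := c
    rcases l with _ | l
    · rw [show flip bind (TM2.step (M i).tm.m) (some ⟨none, w, T⟩) = none from rfl,
        iterate_bind_none] at h
      cases h
    · rw [← ih _ h]
      congr 1
      change some (TM2.stepAux (F.trStmt M i ((M i).tm.m l)) _ _) = _
      rw [stepAux_trStmt]
      simp [trCfg]

theorem update_nil {K : Type*} [DecidableEq K] {Γ : K → Type*} (k₀ : K) :
    update (fun k => ([] : List (Γ k))) k₀ [] = fun _ => [] :=
  update_eq_self_iff.2 rfl

/-- The contents of an oracle machine between calls. -/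
def portStk (u v : List Sym) (i : ι) : ∀ k, List ((M i).tm.Γ k) := fun k =>
  update (fun _ => []) (M i).tm.k₀ (u.map (M i).inputAlphabet.symm) k ++
    update (fun k => ([] : List ((M i).tm.Γ k))) (M i).tm.k₁ (v.map (M i).outputAlphabet.symm) k

/-- The stacks of the compiled machine for a state of the flowchart. -/
def stkOf (S : State R ι) : ∀ k, List (Γ R M k) :=
  stks (fun r => S (.inl r)) fun i => portStk (S (.inr (.inl i))) (S (.inr (.inr i))) i

/-- The configuration of the compiled machine for a configuration of the flowchart. -/
def cfgOf (c : Ctrl ι L) (S : State R ι) : TM2.Cfg (Γ R M) (Λ L M) (σ M) :=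
  ⟨ctrlLabel M c, initσ M, stkOf S⟩

theorem stepAux_pushStmt (S : State R ι) (x : (R ⊕ ι) × Sym) (q : BStmt R L M) (v) :
    TM2.stepAux (pushStmt M q x) v (stkOf S)
      = TM2.stepAux q v (stkOf (update S (Port.push x.1) (x.2 :: S (Port.push x.1)))) := by
  obtain ⟨r | i, s⟩ := x
  · simp only [pushStmt, TM2.stepAux, Port.push, stkOf]
    rw [update_stks_inl]
    congr 2
    funext r'
    by_cases h : r' = r
    · subst h; simp [stks]
    · simp [h]
  · simp only [pushStmt, TM2.stepAux, Port.push, stkOf]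
    rw [update_stks_inr]
    congr 2
    funext j
    by_cases h : j = i
    · subst h
      funext k
      by_cases h' : k = (M j).tm.k₀
      · subst h'; simp [stks, portStk]
      · simp [portStk, h']
    · simp [h]

theorem stepAux_pushAll (xs : List ((R ⊕ ι) × Sym)) (S : State R ι) (q : BStmt R L M) (v) :
    TM2.stepAux (xs.foldr (fun x q => pushStmt M q x) q) v (stkOf S)
      = TM2.stepAux q v (stkOf (pushAll S xs)) := by
  induction xs generalizing S with
  | nil => rfl
  | cons x xs ih => rw [List.foldr_cons, stepAux_pushStmt, ih]; rfl

theorem stepAux_actStmt (a : List ((R ⊕ ι) × Sym) × Ctrl ι L) (S : State R ι) (o) :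
    TM2.stepAux (actStmt M a) (o, (initσ M).2) (stkOf S) = cfgOf a.2 (pushAll S a.1) := by
  simp only [actStmt, TM2.stepAux]
  rw [stepAux_pushAll]
  rcases a.2 with _ | _ | _ <;> rfl

theorem stepAux_caseStmt (act : Option Sym → List ((R ⊕ ι) × Sym) × Ctrl ι L)
    (S : State R ι) (o) :
    TM2.stepAux (caseStmt M act) (o, (initσ M).2) (stkOf S)
      = cfgOf (act o).2 (pushAll S (act o).1) := by
  rcases o with _ | _ | _ | _ <;>
  · simp only [caseStmt, TM2.stepAux]
    simp [stepAux_actStmt]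

theorem stepAux_nodeStmt (p : R ⊕ ι) (act : Option Sym → List ((R ⊕ ι) × Sym) × Ctrl ι L)
    (S : State R ι) (hp : ∀ i, p = .inr i → S (.inr (.inl i)) = []) :
    TM2.stepAux (nodeStmt M p act) (initσ M) (stkOf S)
      = cfgOf (act (S (Port.pop p)).head?).2
        (pushAll (update S (Port.pop p) (S (Port.pop p)).tail)
          (act (S (Port.pop p)).head?).1) := by
  rcases p with r | i
  · simp only [nodeStmt, TM2.stepAux]
    rw [← stepAux_caseStmt]
    congr 1
    simp only [stkOf, Port.pop]
    rw [update_stks_inl]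
    congr 1
    funext r'
    by_cases h : r' = r
    · subst h; simp [stks]
    · simp [h]
  · have h0 := hp i rfl
    simp only [nodeStmt, TM2.stepAux]
    rw [← stepAux_caseStmt]
    have hk : stkOf (M := M) S (.inr ⟨i, (M i).tm.k₁⟩)
        = (S (.inr (.inr i))).map (M i).outputAlphabet.symm := by
      simp only [stkOf, stks, portStk, h0, List.map_nil, update_self]
      rw [update_nil]; simp
    rw [hk]
    congr 1
    · simp only [Port.pop, initσ, Prod.mk.injEq, and_true]
      cases S (.inr (.inr i)) <;> simp
    · rw [stkOf, update_stks_inr]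
      simp only [stkOf, Port.pop]
      congr 1
      funext j
      by_cases h : j = i
      · subst h
        funext k
        by_cases h' : k = (M j).tm.k₁
        · subst h'; simp [portStk, h0]
        · simp [portStk, h', h0]
      · simp [h]

/-- The machine `A` turns the input `u` into the output `v` in time `t`. -/
def Answers (A : TM2ComputableAux Sym Sym) (u v : List Sym) (t : ℕ) : Prop :=
  Nonempty (TM2OutputsInTime A.tm (u.map A.inputAlphabet.invFun)
    (some (v.map A.outputAlphabet.invFun)) t)

theorem initList_eq (tm : FinTM2) (s : List (tm.Γ tm.k₀)) :
    initList tm s = ⟨some tm.main, tm.initialState, update (fun _ => []) tm.k₀ s⟩ := by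
  simp only [initList]
  congr 1
  funext k
  by_cases h : k = tm.k₀
  · subst h; simp
  · simp [h]

theorem haltList_eq (tm : FinTM2) (s : List (tm.Γ tm.k₁)) :
    haltList tm s = ⟨none, tm.initialState, update (fun _ => []) tm.k₁ s⟩ := by
  simp only [haltList]
  congr 1
  funext k
  by_cases h : k = tm.k₁
  · subst h; simp
  · simp [h]

/-- The compiled machine simulates the flowchart. -/
theorem Run.iterate {c c' : Ctrl ι L} {S S' : State R ι} {t : ℕ}
    (h : F.Run (fun i => Answers (M i)) c S t c' S') :
    ∃ s ≤ t, (flip bind (TM2.step (F.prog M)))^[s] (some (cfgOf c S)) = some (cfgOf c' S') := by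
  induction h with
  | refl c S => exact ⟨0, le_rfl, rfl⟩
  | node l S t c T hi _ ih =>
    obtain ⟨s, hs, ih⟩ := ih
    refine ⟨s + 1, by omega, ?_⟩
    rw [iterate_succ_apply, ← ih]
    congr 1
    change some (TM2.stepAux (nodeStmt M (F.pop l) (F.act l)) _ _) = _
    rw [stepAux_nodeStmt _ _ _ hi]
  | call i S v t₀ t c T hO h0 _ ih =>
    obtain ⟨s, hs, ih⟩ := ih
    obtain ⟨⟨⟨n, hn⟩, hle⟩⟩ := hO
    refine ⟨s + n, by simp only at hle; omega, ?_⟩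
    rw [iterate_add_apply, ← ih]
    congr 1
    have := iterate_trCfg (F := F) (M := M) i (initσ M) (fun r => S (.inl r))
      (fun i => portStk (S (.inr (.inl i))) (S (.inr (.inr i))) i) n _ _ hn
    convert this using 2
    · rw [initList_eq]
      simp only [cfgOf, ctrlLabel, trCfg, trLabel, initσ, update_eq_self, stkOf]
      congr 2
      refine congrArg (stks _) ?_
      funext j
      by_cases h : j = i
      · subst h
        funext k
        simp [portStk, h0]
      · simp [h]
    · rw [haltList_eq]
      simp only [cfgOf, ctrlLabel, trCfg, trLabel, initσ, update_eq_self, stkOf]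
      congr 2
      funext j
      by_cases h : j = i
      · subst h
        funext k
        simp [portStk]
      · simp [h]

variable (F M) in
/-- The compiled machine. -/
def compile [Fintype R] [Fintype L] [Fintype ι] : TM2ComputableAux Sym Sym where
  tm :=
    { K := K R M
      kDecidableEq := inferInstance
      kFin := by
        haveI := fun i => (M i).tm.kFin
        infer_instance
      k₀ := .inl F.src
      k₁ := .inl F.dst
      Γ := Γ R M
      Λ := Λ L M
      ΛFin := by
        haveI := fun i => (M i).tm.ΛFin
        infer_instance
      main := .inl F.start
      σ := σ M
      initialState := initσ M
      σFin := by
        haveI := fun i => (M i).tm.σFin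
        infer_instance
      Γk₀Fin := inferInstanceAs (Fintype Sym)
      m := F.prog M }
  inputAlphabet := Equiv.refl Sym
  outputAlphabet := Equiv.refl Sym

/-- Only register `r` holds anything. -/
def only (r : R) (u : List Sym) : State R ι := update (fun _ => []) (.inl r) u

theorem stkOf_only (r : R) (u : List Sym) :
    stkOf (M := M) (only r u)
      = update (fun k : K R M => ([] : List (Γ R M k))) (Sum.inl r) u := by
  funext k
  rcases k with r' | ⟨i, k⟩
  · by_cases h : r' = r
    · subst h; simp [stkOf, stks, only]
    · rw [update_of_ne (by simpa using h)]; simp [stkOf, stks, only, h]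
  · rw [update_of_ne (by simp)]
    simp only [stkOf, stks, only, ne_eq, reduceCtorEq, not_false_eq_true, update_of_ne, portStk,
      List.map_nil, update_nil, List.append_nil]

theorem compile_answers [Fintype R] [Fintype L] [Fintype ι] {u v : List Sym} {t : ℕ}
    (h : F.Run (fun i => Answers (M i)) (.goto F.start) (only F.src u) t .halt (only F.dst v)) :
    Answers (F.compile M) u v t := by
  obtain ⟨s, hs, h⟩ := h.iterate
  refine ⟨⟨⟨s, ?_⟩, hs⟩⟩
  have e : ∀ w : List Sym, w.map (Equiv.refl Sym).invFun = w := List.map_id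
  rw [initList_eq]
  simp only [Option.map_some]
  rw [haltList_eq]
  simp only [cfgOf, stkOf_only] at h
  change (flip bind (TM2.step (F.prog M)))^[s] (some ⟨_, _, update _ _ (u.map _)⟩)
    = some ⟨_, _, update _ _ (v.map _)⟩
  refine Eq.trans ?_ (h.trans ?_)
  · congr 4; exact e u
  · congr 3; exact (e v).symm

end Flow

/-! ### Output length -/

/-- The number of push operations in a statement. -/
def pushCount {K : Type} {Γ : K → Type} {Λ σ : Type} : TM2.Stmt Γ Λ σ → ℕ
  | .push _ _ q => pushCount q + 1
  | .peek _ _ q => pushCount q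
  | .pop _ _ q => pushCount q
  | .load _ q => pushCount q
  | .branch _ q₁ q₂ => pushCount q₁ + pushCount q₂
  | .goto _ => 0
  | .halt => 0

theorem length_stepAux_le {K : Type} [DecidableEq K] {Γ : K → Type} {Λ σ : Type}
    (q : TM2.Stmt Γ Λ σ) (v : σ) (S : ∀ k, List (Γ k)) (k : K) :
    ((TM2.stepAux q v S).stk k).length ≤ (S k).length + pushCount q := by
  induction q generalizing v S with
  | push k' f q ih =>
    refine (ih _ _).trans ?_
    by_cases h : k = k'
    · subst h; simp [pushCount]; omega
    · simp [h, pushCount]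
  | peek k' f q ih => exact ih _ _
  | pop k' f q ih =>
    refine (ih _ _).trans ?_
    by_cases h : k = k'
    · subst h; simp [pushCount]
    · simp [h, pushCount]
  | load f q ih => exact ih _ _
  | branch f q₁ q₂ ih₁ ih₂ =>
    simp only [TM2.stepAux, pushCount]
    cases f v
    · exact (ih₂ _ _).trans (by omega)
    · exact (ih₁ _ _).trans (by omega)
  | goto f => simp
  | halt => simp

theorem length_iterate_le {K : Type} [DecidableEq K] {Γ : K → Type} {Λ σ : Type}
    (m : Λ → TM2.Stmt Γ Λ σ) (C : ℕ) (hC : ∀ l, pushCount (m l) ≤ C) (n : ℕ)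
    (c c' : TM2.Cfg Γ Λ σ) (h : (flip bind (TM2.step m))^[n] (some c) = some c') (k : K) :
    (c'.stk k).length ≤ (c.stk k).length + n * C := by
  induction n generalizing c with
  | zero =>
    simp only [iterate_zero, id_eq, Option.some.injEq] at h
    simp [h]
  | succ n ih =>
    rw [iterate_succ_apply] at h
    obtain ⟨l, w, T⟩ := c
    rcases l with _ | l
    · rw [show flip bind (TM2.step m) (some ⟨none, w, T⟩) = none from rfl,
        Flow.iterate_bind_none] at h
      cases h
    · refine (ih _ h).trans ?_
      have := length_stepAux_le (m l) w T k
      have := hC l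
      rw [add_mul]
      simp only
      omega

/-- A machine writes boundedly many symbols per step. -/
theorem exists_length_le_of_answers (A : TM2ComputableAux Sym Sym) :
    ∃ C, ∀ u v t, Flow.Answers A u v t → v.length ≤ u.length + t * C := by
  have := A.tm.ΛFin
  refine ⟨Finset.univ.sup fun l => pushCount (A.tm.m l), fun u v t ⟨⟨⟨n, hn⟩, hle⟩⟩ => ?_⟩
  have := length_iterate_le A.tm.m _
    (fun l => Finset.le_sup (f := fun l => pushCount (A.tm.m l)) (Finset.mem_univ l)) n _ _ hn
    A.tm.k₁
  rw [Flow.initList_eq, Flow.haltList_eq] at this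
  simp only [update_self, List.length_map] at this
  refine this.trans (add_le_add ?_ (Nat.mul_le_mul_right _ hle))
  by_cases h : A.tm.k₁ = A.tm.k₀
  · have e : ∀ (k : A.tm.K) (s : List (A.tm.Γ A.tm.k₀)), k = A.tm.k₀ →
        (update (fun k => ([] : List (A.tm.Γ k))) A.tm.k₀ s k).length = s.length := by
      rintro k s rfl; simp
    rw [e _ _ h]; simp
  · simp [h]

/-! ### Polynomially bounded functions -/

/-- Bounded above by a polynomial. -/
def PB (f : ℕ → ℕ) : Prop := ∃ p : Polynomial ℕ, ∀ n, f n ≤ p.eval n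

theorem polynomial_eval_mono (p : Polynomial ℕ) : Monotone fun n : ℕ => p.eval n := by
  intro a b h
  simp only [Polynomial.eval_eq_sum, Polynomial.sum]
  gcongr

namespace PB

theorem poly (p : Polynomial ℕ) : PB fun n => p.eval n := ⟨p, fun _ => le_rfl⟩
theorem const (c : ℕ) : PB fun _ => c := ⟨.C c, by simp⟩
theorem id : PB fun n => n := ⟨.X, by simp⟩
theorem add {f g} : PB f → PB g → PB fun n => f n + g n :=
  fun ⟨p, hp⟩ ⟨q, hq⟩ => ⟨p + q, fun n => by
    rw [Polynomial.eval_add]; exact add_le_add (hp n) (hq n)⟩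
theorem mul {f g} : PB f → PB g → PB fun n => f n * g n :=
  fun ⟨p, hp⟩ ⟨q, hq⟩ => ⟨p * q, fun n => by
    rw [Polynomial.eval_mul]; exact Nat.mul_le_mul (hp n) (hq n)⟩
theorem comp (p : Polynomial ℕ) {f} : PB f → PB fun n => p.eval (f n) :=
  fun ⟨q, hq⟩ => ⟨p.comp q, fun n => by
    rw [Polynomial.eval_comp]; exact polynomial_eval_mono p (hq n)⟩

end PB

/-! ### Closure properties of polynomial time -/

variable {α β γ : Type} {ea : α → List (List Bool)} {eb : β → List (List Bool)}
  {ec : γ → List (List Bool)}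

/-- To show that a function is computable in polynomial time, it suffices to give a
flowchart for it whose oracles are Turing machines. -/
theorem polyTime_of_flow {R L ι : Type} [DecidableEq R] [DecidableEq ι] [Fintype R] [Fintype L]
    [Fintype ι] (F : Flow R L ι)
    (M : ι → TM2ComputableAux Sym Sym) (f : α → β) (T : ℕ → ℕ) (hT : PB T)
    (h : ∀ a, ∃ t ≤ T (encodeStrings (ea a)).length,
      F.Run (fun i => Flow.Answers (M i)) (.goto F.start) (Flow.only F.src (encodeStrings (ea a)))
        t .halt (Flow.only F.dst (encodeStrings (eb (f a))))) :
    PolyTime ea eb f := by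
  obtain ⟨p, hp⟩ := hT
  have h' : ∀ a, Nonempty (TM2OutputsInTime (F.compile M).tm
      ((encodeStrings (ea a)).map (F.compile M).inputAlphabet.invFun)
      (some ((encodeStrings (eb (f a))).map (F.compile M).outputAlphabet.invFun))
      (p.eval (encodeStrings (ea a)).length)) := fun a => by
    obtain ⟨t, ht, hrun⟩ := h a
    obtain ⟨⟨e, he⟩⟩ := Flow.compile_answers hrun
    exact ⟨⟨e, he.trans (ht.trans (hp _))⟩⟩
  exact ⟨⟨F.compile M, p, fun a => (h' a).some⟩⟩

/-- A machine, a time bound and an output length bound for a function computable in polynomial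
time. -/
theorem PolyTime.exists_answers {f : α → β} (h : PolyTime ea eb f) :
    ∃ (A : TM2ComputableAux Sym Sym) (p q : Polynomial ℕ), ∀ a,
      Flow.Answers A (encodeStrings (ea a)) (encodeStrings (eb (f a)))
        (p.eval (encodeStrings (ea a)).length) ∧
      (encodeStrings (eb (f a))).length ≤ q.eval (encodeStrings (ea a)).length := by
  obtain ⟨⟨A, p, h⟩⟩ := h
  obtain ⟨C, hC⟩ := exists_length_le_of_answers A
  refine ⟨A, p, .X + p * .C C, fun a => ⟨⟨h a⟩, ?_⟩⟩
  simpa using hC _ _ _ ⟨h a⟩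

/-! ### Runs of flowcharts, extended at their start -/

section

variable {R ι : Type}

@[simp] theorem Port.push_inl (r : R) : Port.push (.inl r : R ⊕ ι) = .inl r := rfl

@[simp] theorem Port.push_inr (i : ι) : Port.push (.inr i : R ⊕ ι) = .inr (.inl i) := rfl

@[simp] theorem Port.pop_inl (r : R) : Port.pop (.inl r : R ⊕ ι) = .inl r := rfl

@[simp] theorem Port.pop_inr (i : ι) : Port.pop (.inr i : R ⊕ ι) = .inr (.inr i) := rfl

end

namespace Flow

variable {R L ι : Type} [DecidableEq R] [DecidableEq ι] {F : Flow R L ι}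
  {O : ι → List Sym → List Sym → ℕ → Prop}

omit [DecidableEq R] [DecidableEq ι] in
theorem port_push_injective : Injective (Port.push : R ⊕ ι → Port R ι) := by
  rintro (r | i) (r' | i') h <;> simp_all [Port.push]

@[simp]
theorem pushAll_nil (S : State R ι) : pushAll S [] = S := rfl

@[simp]
theorem pushAll_cons (S : State R ι) (x xs) :
    pushAll S (x :: xs) = pushAll (update S (Port.push x.1) (x.2 :: S (Port.push x.1))) xs := rfl

theorem pushAll_map_apply (S : State R ι) (qs : List (R ⊕ ι)) (hqs : qs.Nodup) (s : Sym)
    (x : Port R ι) :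
    pushAll S (qs.map fun q => (q, s)) x
      = if ∃ q ∈ qs, Port.push q = x then s :: S x else S x := by
  induction qs generalizing S with
  | nil => simp [pushAll]
  | cons q qs ih =>
    rw [List.nodup_cons] at hqs
    change pushAll (update S (Port.push q) (s :: S (Port.push q))) (qs.map fun q => (q, s)) x = _
    rw [ih _ hqs.2]
    by_cases hx : Port.push q = x
    · subst hx; simp [port_push_injective.eq_iff, hqs.1]
    · simp only [List.mem_cons, exists_eq_or_imp, hx, false_or, update_of_ne (Ne.symm hx)]

theorem pushAll_same (S : State R ι) (q : R ⊕ ι) (xs : List Sym) :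
    pushAll S (xs.map fun s => (q, s))
      = update S (Port.push q) (xs.reverse ++ S (Port.push q)) := by
  induction xs generalizing S with
  | nil => simp [pushAll]
  | cons s xs ih =>
    change pushAll (update S (Port.push q) (s :: S (Port.push q))) (xs.map fun s => (q, s)) = _
    rw [ih]; simp

/-- A node that repeatedly moves a symbol from `p` to all of `qs`. It reverses the contents of
`p`. -/
theorem Run.move {c S t c' S' ys} {T : State R ι} (h : F.Run O c T t c' S')
    (l : L) (p : R ⊕ ι) (qs : List (R ⊕ ι)) (u : List Sym)
    (hnone : F.act l none = (ys, c) := by rfl)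
    (hpop : F.pop l = p := by rfl) (hqs : qs.Nodup := by simp) (hpq : p ∉ qs := by simp)
    (hact : ∀ s, F.act l (some s) = (qs.map fun q => (q, s), .goto l) := by intro s; rfl)
    (hu : S (Port.pop p) = u := by rfl)
    (hp : ∀ i, p = .inr i → S (.inr (.inl i)) = [] := by simp)
    (hT : (pushAll (fun x => if x = Port.pop p then [] else
      if ∃ q ∈ qs, Port.push q = x then u.reverse ++ S x else S x) ys) = T) :
    F.Run O (.goto l) S (t + (u.length + 1)) c' S' := by
  subst hT
  have hpq' : ¬ ∃ q ∈ qs, Port.push q = Port.pop p := by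
    rintro ⟨q, hq, h⟩
    rcases p with r | i <;> rcases q with r' | i' <;> simp_all [Port.pop, Port.push]
  induction u generalizing S with
  | nil =>
    refine Run.node l S t _ _ (by rwa [hpop]) ?_
    rw [hpop, hu, List.head?_nil, hnone, List.tail_nil]
    convert h using 2
    funext x
    by_cases hx : x = Port.pop p
    · subst hx; simp
    · simp [hx]
  | cons s u ih =>
    refine Run.node l S (t + (u.length + 1)) _ _ (by rwa [hpop]) ?_
    rw [hpop, hu, List.head?_cons, hact]
    refine ih ?_ ?_ ?_
    · rw [pushAll_map_apply _ _ hqs, if_neg hpq']; simp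
    · intro i hi
      rw [pushAll_map_apply _ _ hqs, if_neg]
      · rw [update_of_ne, hp i hi]
        subst hi; simp [Port.pop]
      · subst hi
        rintro ⟨q, hq, h⟩
        rcases q with r' | i' <;> simp_all [Port.push]
    · convert h using 2
      funext x
      rw [pushAll_map_apply _ _ hqs]
      by_cases hx : x = Port.pop p
      · subst hx; simp
      · simp only [if_neg hx, update_of_ne hx]
        split_ifs <;> simp

/-- A node that discards the contents of `p`. -/
theorem Run.clear {c S t c' S'} {T : State R ι} (h : F.Run O c T t c' S')
    (l : L) (p : R ⊕ ι) (u : List Sym)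
    (hnone : F.act l none = ([], c) := by rfl)
    (hpop : F.pop l = p := by rfl)
    (hact : ∀ s, F.act l (some s) = ([], .goto l) := by intro s; rfl)
    (hu : S (Port.pop p) = u := by rfl)
    (hp : ∀ i, p = .inr i → S (.inr (.inl i)) = [] := by simp)
    (hT : update S (Port.pop p) [] = T) :
    F.Run O (.goto l) S (t + (u.length + 1)) c' S' := by
  refine h.move l p [] u hnone hpop (by simp) (by simp) (by simpa using hact) hu hp ?_
  subst hT
  funext x
  simp [pushAll, update_apply]

/-- A single step, for a node that pops the symbol `o`. -/
theorem Run.step {S T : State R ι} {c t c' S' ys} (h : F.Run O c T t c' S') (l : L) (p : R ⊕ ι)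
    (o : Option Sym) (hact : F.act l o = (ys, c) := by rfl) (hpop : F.pop l = p := by rfl)
    (ho : (S (Port.pop p)).head? = o := by rfl)
    (hp : ∀ i, p = .inr i → S (.inr (.inl i)) = [] := by simp)
    (hT : pushAll (update S (Port.pop p) (S (Port.pop p)).tail) ys = T) :
    F.Run O (.goto l) S (t + 1) c' S' := by
  subst hpop ho hT
  refine .node l S t _ _ hp ?_
  rwa [hact]

/-- A call of oracle `i`, which consumes its input. -/
theorem Run.callOracle {S T : State R ι} {t c' S'} {i : ι}
    (h : F.Run O (.goto (F.ret i)) T t c' S') {v t₀} (hO : O i (S (.inr (.inl i))) v t₀)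
    (h₀ : S (.inr (.inr i)) = [] := by rfl)
    (hT : update (update S (.inr (.inl i)) []) (.inr (.inr i)) v = T) :
    F.Run O (.call i) S (t + t₀) c' S' := by
  subst hT
  exact .call i S v t₀ t _ _ hO h₀ h

end Flow

/-! ### Composition and concatenation -/

/-- Run oracle `false`, then oracle `true` on its output. -/
def compFlow : Flow (Fin 3) (Fin 6) Bool where
  start := 0
  src := 0
  dst := 2
  ret i := if i then 4 else 2
  pop
    | 0 => .inl 0
    | 1 => .inl 1
    | 2 => .inr false
    | 3 => .inl 1
    | 4 => .inr true
    | 5 => .inl 1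
  act
    | 0 => fun
      | some s => ([.inl 1].map fun q => (q, s), .goto 0)
      | none => ([], .goto 1)
    | 1 => fun
      | some s => ([.inr false].map fun q => (q, s), .goto 1)
      | none => ([], .call false)
    | 2 => fun
      | some s => ([.inl 1].map fun q => (q, s), .goto 2)
      | none => ([], .goto 3)
    | 3 => fun
      | some s => ([.inr true].map fun q => (q, s), .goto 3)
      | none => ([], .call true)
    | 4 => fun
      | some s => ([.inl 1].map fun q => (q, s), .goto 4)
      | none => ([], .goto 5)
    | 5 => fun
      | some s => ([.inl 2].map fun q => (q, s), .goto 5)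
      | none => ([], .halt)

/-- The storage of `compFlow`. -/
@[simp]
def compState (a b c i₀ o₀ i₁ o₁ : List Sym) : Flow.State (Fin 3) Bool
  | .inl 0 => a
  | .inl 1 => b
  | .inl 2 => c
  | .inr (.inl false) => i₀
  | .inr (.inr false) => o₀
  | .inr (.inl true) => i₁
  | .inr (.inr true) => o₁

theorem compState_ext {S : Flow.State (Fin 3) Bool} {a b c i₀ o₀ i₁ o₁ : List Sym}
    (ha : S (.inl 0) = a) (hb : S (.inl 1) = b) (hc : S (.inl 2) = c)
    (hi₀ : S (.inr (.inl false)) = i₀) (ho₀ : S (.inr (.inr false)) = o₀)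
    (hi₁ : S (.inr (.inl true)) = i₁) (ho₁ : S (.inr (.inr true)) = o₁) :
    S = compState a b c i₀ o₀ i₁ o₁ := by
  funext x
  rcases x with x | (_ | _) | (_ | _)
  · fin_cases x <;> assumption
  all_goals assumption

/-- The run is built from its end, each step being put in front of what follows it. -/
theorem compFlow_run {O : Bool → List Sym → List Sym → ℕ → Prop} {u v w : List Sym} {t t' : ℕ}
    (h : O false u v t) (h' : O true v w t') :
    ∃ s, compFlow.Run O (.goto 0) (Flow.only 0 u) s .halt (Flow.only 2 w) ∧
      s ≤ 2 * u.length + 2 * v.length + 2 * w.length + t + t' + 6 := by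
  have e₀ : Flow.only 0 u = compState u [] [] [] [] [] [] :=
    compState_ext rfl rfl rfl rfl rfl rfl rfl
  have e₁ : Flow.only 2 w = compState [] [] w [] [] [] [] :=
    compState_ext rfl rfl rfl rfl rfl rfl rfl
  rw [e₀, e₁]
  have r := Flow.Run.refl (F := compFlow) (O := O) .halt (compState [] [] w [] [] [] [])
  have r := r.move (S := compState [] w.reverse [] [] [] [] []) 5 (.inl 1) [.inl 2] w.reverse
    (hT := by apply compState_ext <;> simp)
  have r := r.move (S := compState [] [] [] [] [] [] w) 4 (.inr true) [.inl 1] w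
    (hT := by apply compState_ext <;> simp)
  have r := r.callOracle (S := compState [] [] [] [] [] v []) (i := true) h'
    (hT := by apply compState_ext <;> simp)
  have r := r.move (S := compState [] v.reverse [] [] [] [] []) 3 (.inl 1) [.inr true] v.reverse
    (hT := by apply compState_ext <;> simp)
  have r := r.move (S := compState [] [] [] [] v [] []) 2 (.inr false) [.inl 1] v
    (hT := by apply compState_ext <;> simp)
  have r := r.callOracle (S := compState [] [] [] u [] [] []) (i := false) h
    (hT := by apply compState_ext <;> simp)
  have r := r.move (S := compState [] u.reverse [] [] [] [] []) 1 (.inl 1) [.inr false] u.reverse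
    (hT := by apply compState_ext <;> simp)
  have r := r.move (S := compState u [] [] [] [] [] []) 0 (.inl 0) [.inl 1] u
    (hT := by apply compState_ext <;> simp)
  exact ⟨_, r, by simp only [List.length_reverse]; omega⟩

theorem PolyTime.comp {f : α → β} {g : β → γ} (hf : PolyTime ea eb f) (hg : PolyTime eb ec g) :
    PolyTime ea ec (fun a => g (f a)) := by
  obtain ⟨A, p, q, hA⟩ := hf.exists_answers
  obtain ⟨B, p', q', hB⟩ := hg.exists_answers
  refine polyTime_of_flow compFlow (fun i => if i then B else A) _
    (T := fun n =>
      2 * n + 2 * q.eval n + 2 * q'.eval (q.eval n) + p.eval n + p'.eval (q.eval n) + 6)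
    ?_ fun a => ?_
  · exact ((((((PB.const 2).mul .id).add ((PB.const 2).mul (.poly q))).add
      ((PB.const 2).mul (.comp q' (.poly q)))).add (.poly p)).add (.comp p' (.poly q))).add
      (.const 6)
  · obtain ⟨h1, h2⟩ := hA a
    obtain ⟨h3, h4⟩ := hB (f a)
    obtain ⟨s, r, hs⟩ := compFlow_run (O := fun i => Flow.Answers (if i then B else A)) h1 h3
    refine ⟨s, hs.trans ?_, r⟩
    have := polynomial_eval_mono q' h2
    have := polynomial_eval_mono p' h2
    simp only at *
    omega

/-- Run oracles `false` and `true` on the same input. -/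
def appendFlow : Flow (Fin 3) (Fin 5) Bool where
  start := 0
  src := 0
  dst := 2
  ret i := if i then 3 else 2
  pop
    | 0 => .inl 0
    | 1 => .inl 1
    | 2 => .inr false
    | 3 => .inr true
    | 4 => .inl 1
  act
    | 0 => fun
      | some s => ([.inl 1].map fun q => (q, s), .goto 0)
      | none => ([], .goto 1)
    | 1 => fun
      | some s => ([.inr false, .inr true].map fun q => (q, s), .goto 1)
      | none => ([], .call false)
    | 2 => fun
      | some s => ([.inl 1].map fun q => (q, s), .goto 2)
      | none => ([], .call true)
    | 3 => fun
      | some s => ([.inl 1].map fun q => (q, s), .goto 3)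
      | none => ([], .goto 4)
    | 4 => fun
      | some s => ([.inl 2].map fun q => (q, s), .goto 4)
      | none => ([], .halt)

theorem appendFlow_run {O : Bool → List Sym → List Sym → ℕ → Prop} {u v w : List Sym} {t t' : ℕ}
    (h : O false u v t) (h' : O true u w t') :
    ∃ s, appendFlow.Run O (.goto 0) (Flow.only 0 u) s .halt (Flow.only 2 (v ++ w)) ∧
      s ≤ 2 * u.length + 2 * v.length + 2 * w.length + t + t' + 5 := by
  have e₀ : Flow.only 0 u = compState u [] [] [] [] [] [] :=
    compState_ext rfl rfl rfl rfl rfl rfl rfl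
  have e₁ : Flow.only 2 (v ++ w) = compState [] [] (v ++ w) [] [] [] [] :=
    compState_ext rfl rfl rfl rfl rfl rfl rfl
  rw [e₀, e₁]
  have r := Flow.Run.refl (F := appendFlow) (O := O) .halt (compState [] [] (v ++ w) [] [] [] [])
  have r := r.move (S := compState [] (w.reverse ++ v.reverse) [] [] [] [] []) 4 (.inl 1) [.inl 2]
    (w.reverse ++ v.reverse) (hT := by apply compState_ext <;> simp)
  have r := r.move (S := compState [] v.reverse [] [] [] [] w) 3 (.inr true) [.inl 1] w
    (hT := by apply compState_ext <;> simp)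
  have r := r.callOracle (S := compState [] v.reverse [] [] [] u []) (i := true) h'
    (hT := by apply compState_ext <;> simp)
  have r := r.move (S := compState [] [] [] [] v u []) 2 (.inr false) [.inl 1] v
    (hT := by apply compState_ext <;> simp)
  have r := r.callOracle (S := compState [] [] [] u [] u []) (i := false) h
    (hT := by apply compState_ext <;> simp)
  have r := r.move (S := compState [] u.reverse [] [] [] [] []) 1 (.inl 1) [.inr false, .inr true]
    u.reverse (hT := by apply compState_ext <;> simp)
  have r := r.move (S := compState u [] [] [] [] [] []) 0 (.inl 0) [.inl 1] u
    (hT := by apply compState_ext <;> simp)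
  exact ⟨_, r, by simp only [List.length_reverse, List.length_append]; omega⟩

theorem encodeStrings_append (K L : List (List Bool)) :
    encodeStrings (K ++ L) = encodeStrings K ++ encodeStrings L := by
  simp [encodeStrings]

theorem PolyTime.append {f : α → List (List Bool)} {g : α → List (List Bool)}
    (hf : PolyTime ea id f) (hg : PolyTime ea id g) :
    PolyTime ea id (fun a => f a ++ g a) := by
  obtain ⟨A, p, q, hA⟩ := hf.exists_answers
  obtain ⟨B, p', q', hB⟩ := hg.exists_answers
  refine polyTime_of_flow appendFlow (fun i => if i then B else A) _
    (T := fun n => 2 * n + 2 * q.eval n + 2 * q'.eval n + p.eval n + p'.eval n + 5)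
    ?_ fun a => ?_
  · exact ((((((PB.const 2).mul .id).add ((PB.const 2).mul (.poly q))).add
      ((PB.const 2).mul (.poly q'))).add (.poly p)).add (.poly p')).add (.const 5)
  · obtain ⟨h1, h2⟩ := hA a
    obtain ⟨h3, h4⟩ := hB a
    obtain ⟨s, r, hs⟩ := appendFlow_run (O := fun i => Flow.Answers (if i then B else A)) h1 h3
    rw [id, encodeStrings_append]
    refine ⟨s, hs.trans ?_, r⟩
    omega

/-- Only the encoding of the output matters for computability in polynomial time. -/
theorem PolyTime.congr_output {f : α → β} {g : α → γ} (hf : PolyTime ea eb f)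
    (h : ∀ a, eb (f a) = ec (g a)) : PolyTime ea ec g := by
  obtain ⟨⟨A, p, hA⟩⟩ := hf
  exact ⟨⟨A, p, fun a => by rw [← h]; exact hA a⟩⟩

/-! ### Finite transducers with a register -/

/-- A finite transducer which, along with each input symbol, also reads a bit from a register, as
long as the register has any. -/
structure Transducer (Q : Type) where
  init : Q
  step : Q → Sym → Option Bool → Q × List Sym
  final : Q → List Sym

namespace Transducer

variable {Q : Type} (X : Transducer Q)

/-- The output on a register and an input, from a given state. -/
def run (q : Q) : List Bool → List Sym → List Sym
  | _, [] => X.final q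
  | u, s :: v => (X.step q s u.head?).2 ++ run (X.step q s u.head?).1 u.tail v

/-- The nodes of the flowchart of a transducer. -/
inductive Label (Q : Type)
  | load
  | flip
  | read (q : Q)
  | step (q : Q) (s : Sym)
  | clear
  | out

/-- Labels as elements of a type that is known to be finite. -/
def Label.equiv (Q : Type) : Label Q ≃ Fin 4 ⊕ Q ⊕ Q × Sym where
  toFun
    | .load => .inl 0
    | .flip => .inl 1
    | .read q => .inr (.inl q)
    | .step q s => .inr (.inr (q, s))
    | .clear => .inl 2
    | .out => .inl 3
  invFun
    | .inl 0 => .load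
    | .inl 1 => .flip
    | .inl 2 => .clear
    | .inl 3 => .out
    | .inr (.inl q) => .read q
    | .inr (.inr (q, s)) => .step q s
  left_inv x := by cases x <;> rfl
  right_inv x := by
    rcases x with x | x | x
    · fin_cases x <;> rfl
    · rfl
    · rfl

instance [Fintype Q] : Fintype (Label Q) := .ofEquiv _ (Label.equiv Q).symm

/-- Registers: `0` input, `1` auxiliary, `2` register of the transducer, `3` reversed output,
`4` output. If `b`, the first string of the input is put in the register. -/
def flow (b : Bool) : Flow (Fin 5) (Label Q) Empty where
  start := if b then .load else .read X.init
  src := 0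
  dst := 4
  ret := Empty.elim
  pop
    | .load => .inl 0
    | .flip => .inl 1
    | .read _ => .inl 0
    | .step _ _ => .inl 2
    | .clear => .inl 2
    | .out => .inl 3
  act
    | .load => fun
      | some (some b) => ([(.inl 1, some b)], .goto .load)
      | _ => ([], .goto .flip)
    | .flip => fun
      | some s => ([.inl 2].map fun q => (q, s), .goto .flip)
      | none => ([], .goto (.read X.init))
    | .read q => fun
      | some s => ([], .goto (.step q s))
      | none => ((X.final q).map fun s => (.inl 3, s), .goto .clear)
    | .step q s => fun o =>
      ((X.step q s o.join).2.map fun s => (.inl 3, s), .goto (.read (X.step q s o.join).1))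
    | .clear => fun
      | some _ => ([], .goto .clear)
      | none => ([], .goto .out)
    | .out => fun
      | some s => ([.inl 4].map fun q => (q, s), .goto .out)
      | none => ([], .halt)

/-- The storage of the flowchart of a transducer. -/
@[simp]
def state (a b c d e : List Sym) : Flow.State (Fin 5) Empty
  | .inl 0 => a
  | .inl 1 => b
  | .inl 2 => c
  | .inl 3 => d
  | .inl 4 => e

theorem state_ext {S : Flow.State (Fin 5) Empty} {a b c d e : List Sym}
    (ha : S (.inl 0) = a) (hb : S (.inl 1) = b) (hc : S (.inl 2) = c)
    (hd : S (.inl 3) = d) (he : S (.inl 4) = e) :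
    S = state a b c d e := by
  funext x
  rcases x with x | x | x
  · fin_cases x <;> assumption
  · exact x.elim
  · exact x.elim

variable {O : Empty → List Sym → List Sym → ℕ → Prop} {b : Bool}

theorem run_out (w : List Sym) : (X.flow b).Run O (.goto .out) (state [] [] [] w.reverse [])
    (w.length + 1) .halt (state [] [] [] [] w) := by
  have r := Flow.Run.refl (F := X.flow b) (O := O) .halt (state [] [] [] [] w)
  have r := r.move (S := state [] [] [] w.reverse []) .out (.inl 3) [.inl 4] w.reverse
    (hT := by apply state_ext <;> simp)
  simpa using r

theorem run_read (C : ℕ) (hC : ∀ q s o, (X.step q s o).2.length ≤ C)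
    (hC' : ∀ q, (X.final q).length ≤ C) (q : Q) (u : List Bool) (v w : List Sym) :
    ∃ s, (X.flow b).Run O (.goto (.read q)) (state v [] (u.map some) w.reverse []) s .halt
      (state [] [] [] [] (w ++ X.run q u v)) ∧
      s ≤ (C + 2) * (v.length + 1) + w.length + u.length + 2 := by
  induction v generalizing q u w with
  | nil =>
    have r := X.run_out (O := O) (b := b) (w ++ X.final q)
    have r := r.clear (S := state [] [] (u.map some) (w ++ X.final q).reverse []) .clear (.inl 2)
      (u.map some) (hT := by apply state_ext <;> simp)
    have r := r.step (S := state [] [] (u.map some) w.reverse []) (.read q) (.inl 0) none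
      (hT := by rw [Flow.pushAll_same]; apply state_ext <;> simp)
    refine ⟨_, r, ?_⟩
    have := hC' q
    simp only [List.length_append, List.length_map, List.length_nil]
    nlinarith
  | cons s v ih =>
    obtain ⟨t, r, ht⟩ := ih (X.step q s u.head?).1 u.tail (w ++ (X.step q s u.head?).2)
    have e : ((u.map some).head?).join = u.head? := by cases u <;> rfl
    have r := r.step (S := state v [] (u.map some) w.reverse []) (.step q s) (.inl 2)
      (u.map some).head? (hact := by rw [← e]; rfl)
      (hT := by rw [Flow.pushAll_same, e]; apply state_ext <;> simp)
    have r := r.step (S := state (s :: v) [] (u.map some) w.reverse []) (.read q) (.inl 0) (some s)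
      (hT := by apply state_ext <;> simp)
    refine ⟨_, by simpa [run] using r, ?_⟩
    have := hC q s u.head?
    simp only [List.length_append, List.length_cons, List.length_tail] at ht ⊢
    have h1 : u.length - 1 ≤ u.length := Nat.sub_le _ _
    nlinarith

theorem exists_length_le [Fintype Q] : ∃ C, (∀ q s o, (X.step q s o).2.length ≤ C) ∧
    ∀ q, (X.final q).length ≤ C := by
  refine ⟨(Finset.univ.sup fun x : Q × Sym × Option Bool => (X.step x.1 x.2.1 x.2.2).2.length)
    + Finset.univ.sup fun q => (X.final q).length, fun q s o => ?_, fun q => ?_⟩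
  · exact (Finset.le_sup (f := fun x : Q × Sym × Option Bool =>
      (X.step x.1 x.2.1 x.2.2).2.length) (Finset.mem_univ (q, s, o))).trans (Nat.le_add_right _ _)
  · exact (Finset.le_sup (f := fun q => (X.final q).length) (Finset.mem_univ q)).trans
      (Nat.le_add_left _ _)

/-- What a finite transducer computes is computable in polynomial time. -/
theorem polyTime [Fintype Q] {f : α → β}
    (hf : ∀ a, encodeStrings (eb (f a)) = X.run X.init [] (encodeStrings (ea a))) :
    PolyTime ea eb f := by
  obtain ⟨C, hC, hC'⟩ := X.exists_length_le
  refine polyTime_of_flow (X.flow false) Empty.elim _ (T := fun n => (C + 2) * (n + 1) + 2) ?_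
    fun a => ?_
  · exact ((PB.const _).mul (PB.id.add (.const 1))).add (.const 2)
  · obtain ⟨s, r, hs⟩ := X.run_read (b := false)
      (O := fun i => Flow.Answers (Empty.elim i)) C hC hC' X.init []
      (encodeStrings (ea a)) []
    refine ⟨s, by simpa using hs, ?_⟩
    have e₀ : Flow.only 0 (encodeStrings (ea a)) = state (encodeStrings (ea a)) [] [] [] [] :=
      state_ext rfl rfl rfl rfl rfl
    have e₁ (w) : Flow.only 4 w = state [] [] [] [] w := state_ext rfl rfl rfl rfl rfl
    rw [hf]
    change Flow.Run _ _ _ (Flow.only 0 _) _ _ (Flow.only 4 _)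
    rw [e₀, e₁]
    exact r

theorem encodeStrings_cons (u : List Bool) (L : List (List Bool)) :
    encodeStrings (u :: L) = u.map some ++ none :: encodeStrings L := by
  simp [encodeStrings]

theorem run_load (u : List Bool) (v w : List Sym) {t : ℕ} {c S}
    (h : (X.flow true).Run O (.goto .flip) (state v ((u.map some).reverse ++ w) [] [] []) t c S) :
    (X.flow true).Run O (.goto .load) (state (u.map some ++ none :: v) w [] [] [])
      (t + (u.length + 1)) c S := by
  induction u generalizing w with
  | nil =>
    have r := h.step (S := state (none :: v) w [] [] []) .load (.inl 0) (some none)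
      (hT := by apply state_ext <;> simp)
    simpa using r
  | cons b u ih =>
    have r := ih (some b :: w) (by simpa using h)
    have r := r.step (S := state (some b :: (u.map some ++ none :: v)) w [] [] []) .load (.inl 0)
      (some (some b)) (hT := by apply state_ext <;> simp)
    simpa [add_assoc] using r

/-- What a finite transducer computes with the first string in its register is computable in
polynomial time. -/
theorem polyTime_register [Fintype Q] {f : α → β} (u : α → List Bool) (L : α → List (List Bool))
    (hL : ∀ a, ea a = u a :: L a)
    (hf : ∀ a, encodeStrings (eb (f a)) = X.run X.init (u a) (encodeStrings (L a))) :
    PolyTime ea eb f := by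
  obtain ⟨C, hC, hC'⟩ := X.exists_length_le
  refine polyTime_of_flow (X.flow true) Empty.elim _
    (T := fun n => (C + 2) * (n + 1) + 3 * n + 4) ?_ fun a => ?_
  · exact (((PB.const _).mul (PB.id.add (.const 1))).add ((PB.const 3).mul .id)).add (.const 4)
  · obtain ⟨s, r, hs⟩ := X.run_read (b := true)
      (O := fun i => Flow.Answers (Empty.elim i)) C hC hC' X.init (u a)
      (encodeStrings (L a)) []
    rw [hf]
    have r := r.move (S := state (encodeStrings (L a)) ((u a).map some).reverse [] [] []) .flip
      (.inl 1) [.inl 2] ((u a).map some).reverse (hT := by apply state_ext <;> simp)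
    have r := X.run_load (u a) (encodeStrings (L a)) [] (by simpa using r)
    have e₀ (w) : Flow.only 0 w = state w [] [] [] [] := state_ext rfl rfl rfl rfl rfl
    have e₁ (w) : Flow.only 4 w = state [] [] [] [] w := state_ext rfl rfl rfl rfl rfl
    refine ⟨s + ((u a).length + 1) + ((u a).length + 1), ?_, ?_⟩
    · simp only [hL, encodeStrings_cons, List.length_append, List.length_cons, List.length_map,
        List.length_nil] at hs ⊢
      nlinarith
    · change Flow.Run _ _ _ (Flow.only 0 _) _ _ (Flow.only 4 _)
      rw [e₀, e₁, hL, encodeStrings_cons]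
      exact r

end Transducer

open Transducer

/-! ### Running a machine on each string of a tuple -/

/-- Call the oracle on each string of the input but the first, the context, which is put in front.
Registers: `0` input, `1` reversed context, `2` and `3` auxiliary, `4` reversed output,
`5` output. -/
def flatMapFlow : Flow (Fin 6) (Fin 8) Unit where
  start := 0
  src := 0
  dst := 5
  ret _ := 5
  pop
    | 0 => .inl 0
    | 1 => .inl 0
    | 2 => .inl 3
    | 3 => .inl 1
    | 4 => .inl 2
    | 5 => .inr ()
    | 6 => .inl 1
    | 7 => .inl 4
  act
    -- Read the context.
    | 0 => fun
      | some (some b) => ([(.inl 1, some b)], .goto 0)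
      | _ => ([], .goto 1)
    -- Read the next string.
    | 1 => fun
      | some (some b) => ([(.inl 3, some b)], .goto 1)
      | some none => ([(.inl 3, none)], .goto 2)
      | none => ([], .goto 6)
    -- Put this string on the input of the oracle, with a separator in front.
    | 2 => fun
      | some s => ([.inr ()].map fun q => (q, s), .goto 2)
      | none => ([(.inr (), none)], .goto 3)
    -- Put the context in front, and keep a copy.
    | 3 => fun
      | some s => ([.inr (), .inl 2].map fun q => (q, s), .goto 3)
      | none => ([], .goto 4)
    -- Restore the context from the copy.
    | 4 => fun
      | some s => ([.inl 1].map fun q => (q, s), .goto 4)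
      | none => ([], .call ())
    -- Collect the answer of the oracle.
    | 5 => fun
      | some s => ([.inl 4].map fun q => (q, s), .goto 5)
      | none => ([], .goto 1)
    | 6 => fun
      | some _ => ([], .goto 6)
      | none => ([], .goto 7)
    | 7 => fun
      | some s => ([.inl 5].map fun q => (q, s), .goto 7)
      | none => ([], .halt)

namespace flatMapFlow

/-- The storage of `flatMapFlow`. -/
@[simp]
def state (a b c d e f i o : List Sym) : Flow.State (Fin 6) Unit
  | .inl 0 => a
  | .inl 1 => b
  | .inl 2 => c
  | .inl 3 => d
  | .inl 4 => e
  | .inl 5 => f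
  | .inr (.inl _) => i
  | .inr (.inr _) => o

theorem state_ext {S : Flow.State (Fin 6) Unit} {a b c d e f i o : List Sym}
    (ha : S (.inl 0) = a) (hb : S (.inl 1) = b) (hc : S (.inl 2) = c) (hd : S (.inl 3) = d)
    (he : S (.inl 4) = e) (hf : S (.inl 5) = f) (hi : S (.inr (.inl ())) = i)
    (ho : S (.inr (.inr ())) = o) :
    S = state a b c d e f i o := by
  funext x
  rcases x with x | x | x
  · fin_cases x <;> assumption
  · exact hi
  · exact ho

variable {O : Unit → List Sym → List Sym → ℕ → Prop}

theorem run_load (u : List Bool) (v w : List Sym) {t : ℕ} {c S}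
    (h : flatMapFlow.Run O (.goto 1) (state v ((u.map some).reverse ++ w) [] [] [] [] [] [])
      t c S) :
    flatMapFlow.Run O (.goto 0) (state (u.map some ++ none :: v) w [] [] [] [] [] [])
      (t + (u.length + 1)) c S := by
  induction u generalizing w with
  | nil =>
    have r := h.step (S := state (none :: v) w [] [] [] [] [] []) 0 (.inl 0) (some none)
      (hT := by apply state_ext <;> simp)
    simpa using r
  | cons b u ih =>
    have r := ih (some b :: w) (by simpa using h)
    have r := r.step (S := state (some b :: (u.map some ++ none :: v)) w [] [] [] [] [] []) 0
      (.inl 0) (some (some b)) (hT := by apply state_ext <;> simp)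
    simpa [add_assoc] using r

theorem run_next (u : List Bool) (v w b e : List Sym) {t : ℕ} {c S}
    (h : flatMapFlow.Run O (.goto 2)
      (state v b [] (none :: ((u.map some).reverse ++ w)) e [] [] []) t c S) :
    flatMapFlow.Run O (.goto 1) (state (u.map some ++ none :: v) b [] w e [] [] [])
      (t + (u.length + 1)) c S := by
  induction u generalizing w with
  | nil =>
    have r := h.step (S := state (none :: v) b [] w e [] [] []) 1 (.inl 0) (some none)
      (hT := by apply state_ext <;> simp)
    simpa using r
  | cons a u ih =>
    have r := ih (some a :: w) (by simpa using h)
    have r := r.step (S := state (some a :: (u.map some ++ none :: v)) b [] w e [] [] []) 1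
      (.inl 0) (some (some a)) (hT := by apply state_ext <;> simp)
    simpa [add_assoc] using r

/-- The loop over the strings `us`, with the context `c`. -/
theorem run_loop (c : List Bool) (g : List Bool → List (List Bool)) (N P Q : ℕ)
    (us : List (List Bool))
    (hg : ∀ u ∈ us, O () (encodeStrings [c, u]) (encodeStrings (g u)) P ∧
      (encodeStrings (g u)).length ≤ Q ∧ c.length + u.length + 2 ≤ N) (w : List Sym) :
    ∃ s, flatMapFlow.Run O (.goto 1)
      (state (encodeStrings us) (c.map some).reverse [] [] w.reverse [] [] []) s .halt
      (state [] [] [] [] [] (w ++ encodeStrings (us.flatMap g)) [] []) ∧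
      s ≤ us.length * (2 * N + P + 2 * Q + 4) + w.length + c.length + 3 := by
  induction us generalizing w with
  | nil =>
    have r := Flow.Run.refl (F := flatMapFlow) (O := O) .halt (state [] [] [] [] [] w [] [])
    have r := r.move (S := state [] [] [] [] w.reverse [] [] []) 7 (.inl 4) [.inl 5] w.reverse
      (hT := by apply state_ext <;> simp)
    have r := r.clear (S := state [] (c.map some).reverse [] [] w.reverse [] [] []) 6 (.inl 1)
      (c.map some).reverse (hT := by apply state_ext <;> simp)
    have r := r.step (S := state [] (c.map some).reverse [] [] w.reverse [] [] []) 1 (.inl 0) none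
      (hT := by apply state_ext <;> simp)
    refine ⟨_, by simpa [encodeStrings] using r, ?_⟩
    simp only [List.length_nil]
    omega
  | cons u us ih =>
    obtain ⟨hO, hQ, hN⟩ := hg u (by simp)
    obtain ⟨s, r, hs⟩ := ih (fun u hu => hg u (by simp [hu])) (w ++ encodeStrings (g u))
    set v := encodeStrings us
    set b := (c.map some).reverse
    have r := r.move (S := state v b [] [] w.reverse [] [] (encodeStrings (g u))) 5 (.inr ())
      [.inl 4] (encodeStrings (g u)) (hT := by apply state_ext <;> simp)
    have r := r.callOracle (S := state v b [] [] w.reverse [] (encodeStrings [c, u]) []) (i := ())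
      hO (hT := by apply state_ext <;> simp)
    have r := r.move
      (S := state v [] (c.map some) [] w.reverse [] (encodeStrings [c, u]) []) 4
      (.inl 2) [.inl 1] (c.map some) (hT := by apply state_ext <;> simp [b])
    have r := r.move
      (S := state v b [] [] w.reverse [] (none :: encodeStrings [u]) []) 3
      (.inl 1) [.inr (), .inl 2] b (hT := by apply state_ext <;> simp [b, encodeStrings_cons])
    have r := r.move
      (S := state v b [] (none :: (u.map some).reverse) w.reverse [] [] []) 2
      (.inl 3) [.inr ()] (none :: (u.map some).reverse)
      (hT := by apply state_ext <;> simp [encodeStrings])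
    have r := run_next u v [] b w.reverse (by simpa using r)
    refine ⟨_, by simpa [encodeStrings_cons, encodeStrings_append] using r, ?_⟩
    simp only [List.length_reverse, List.length_map, List.length_append, b,
      List.length_cons] at hs ⊢
    rw [add_mul]
    omega

end flatMapFlow

theorem length_encodeStrings (L : List (List Bool)) :
    (encodeStrings L).length = (L.map fun w => w.length + 1).sum := by
  induction L with
  | nil => rfl
  | cons u L ih => rw [encodeStrings_cons]; simp [ih]; omega

theorem length_lt_of_mem {L : List (List Bool)} {u : List Bool} (h : u ∈ L) :
    u.length + 1 ≤ (encodeStrings L).length := by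
  rw [length_encodeStrings]
  exact List.single_le_sum (by simp) _ (List.mem_map_of_mem h)

theorem length_le_encodeStrings (L : List (List Bool)) : L.length ≤ (encodeStrings L).length := by
  induction L with
  | nil => simp
  | cons u L ih => rw [encodeStrings_cons]; simp; omega

/-- If `g` is computable in polynomial time, then so is applying `g c` to all strings of a
tuple, and concatenating the results. -/
theorem PolyTime.flatMap {g : List Bool × List Bool → List (List Bool)}
    (hg : PolyTime (fun x => [x.1, x.2]) id g) {c : α → List Bool} {L : α → List (List Bool)}
    (h : PolyTime ea id fun a => c a :: L a) :
    PolyTime ea id fun a => (L a).flatMap fun u => g (c a, u) := by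
  refine h.comp (f := fun a => c a :: L a)
    (g := fun L => L.tail.flatMap fun u => g (L.headD [], u)) ?_ |>.congr_output fun a => rfl
  obtain ⟨A, p, q, hA⟩ := hg.exists_answers
  refine polyTime_of_flow flatMapFlow (fun _ => A) _
    (T := fun n => n * (2 * n + p.eval n + 2 * q.eval n + 4) + 2 * n + 4) ?_ fun L => ?_
  · exact ((PB.id.mul (((((PB.const 2).mul .id).add (.poly p)).add
      ((PB.const 2).mul (.poly q))).add (.const 4))).add ((PB.const 2).mul .id)).add (.const 4)
  have e₀ (w) : Flow.only 0 w = flatMapFlow.state w [] [] [] [] [] [] [] :=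
    flatMapFlow.state_ext rfl rfl rfl rfl rfl rfl rfl rfl
  have e₁ (w) : Flow.only 5 w = flatMapFlow.state [] [] [] [] [] w [] [] :=
    flatMapFlow.state_ext rfl rfl rfl rfl rfl rfl rfl rfl
  change ∃ t ≤ _, Flow.Run _ _ (.goto (0 : Fin 8)) (Flow.only 0 _) _ _ (Flow.only 5 _)
  rw [e₀, e₁]
  rcases L with _ | ⟨c, us⟩
  · obtain ⟨s, r, hs⟩ := flatMapFlow.run_loop (O := fun i => Flow.Answers A) [] (fun _ => []) 0 0 0
      [] (by simp) []
    have r := r.step (S := flatMapFlow.state [] [] [] [] [] [] [] []) 0 (.inl 0) none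
      (hT := by apply flatMapFlow.state_ext <;> simp [encodeStrings])
    exact ⟨_, by simp at hs ⊢; omega, r⟩
  · set n := (encodeStrings (id (c :: us))).length with hn
    have hn' : n = c.length + 1 + (encodeStrings us).length := by
      rw [hn, id, encodeStrings_cons]; simp; omega
    obtain ⟨s, r, hs⟩ := flatMapFlow.run_loop (O := fun i => Flow.Answers A) c
      (fun u => g (c, u)) n (p.eval n) (q.eval n) us (fun u hu => by
        have h1 := length_lt_of_mem hu
        obtain ⟨h2, h3⟩ := hA (c, u)
        have h4 : (encodeStrings [c, u]).length ≤ n := by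
          simp [encodeStrings]; omega
        refine ⟨?_, h3.trans (polynomial_eval_mono q h4), by omega⟩
        obtain ⟨e⟩ := h2
        exact ⟨e.1, e.2.trans (polynomial_eval_mono p h4)⟩) []
    have r := flatMapFlow.run_load c (encodeStrings us) [] (by simpa using r)
    refine ⟨_, ?_, by simpa [encodeStrings_cons] using r⟩
    have := Nat.mul_le_mul_right (2 * n + p.eval n + 2 * q.eval n + 4)
      ((length_le_encodeStrings us).trans (by omega : _ ≤ n))
    simp only [List.length_nil] at hs
    omega

/-! ### Elementary functions computable in polynomial time -/

/-- A string as a tuple of strings. -/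
abbrev single (w : List Bool) : List (List Bool) := [w]

theorem encodeStrings_nil : encodeStrings [] = [] := rfl

theorem encodeStrings_singleton (u : List Bool) :
    encodeStrings [u] = u.map some ++ [none] := by
  simp [encodeStrings]

/-- Drops everything up to the first separator. -/
def tailTransducer : Transducer Bool where
  init := false
  step
    | false, none, _ => (true, [])
    | false, some _, _ => (false, [])
    | true, s, _ => (true, [s])
  final _ := []

theorem polyTime_tail : PolyTime id id (List.tail : List (List Bool) → List (List Bool)) := by
  refine tailTransducer.polyTime fun L => ?_
  have h1 (v : List Sym) : tailTransducer.run true [] v = v := by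
    induction v with
    | nil => rfl
    | cons s v ih => simpa [run, tailTransducer] using ih
  have h2 (u : List Bool) (v : List Sym) :
      tailTransducer.run false [] (u.map some ++ none :: v) = v := by
    induction u with
    | nil => simpa [run, tailTransducer] using h1 v
    | cons b u ih => simpa [run, tailTransducer] using ih
  rcases L with _ | ⟨u, L⟩
  · rfl
  · exact (h2 u (encodeStrings L)).symm.trans (by rw [id, encodeStrings_cons]; rfl)

/-- Keeps everything up to the first separator, which is supplied if there is none. -/
def headTransducer : Transducer Bool where
  init := true
  step
    | true, none, _ => (false, [none])
    | true, some b, _ => (true, [some b])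
    | false, _, _ => (false, [])
  final
    | true => [none]
    | false => []

theorem polyTime_head : PolyTime id single (fun L : List (List Bool) => L.headD []) := by
  refine headTransducer.polyTime fun L => ?_
  have h1 (v : List Sym) : headTransducer.run false [] v = [] := by
    induction v with
    | nil => rfl
    | cons s v ih => simpa [run, headTransducer] using ih
  have h2 (u : List Bool) (v : List Sym) :
      headTransducer.run true [] (u.map some ++ none :: v) = u.map some ++ [none] := by
    induction u with
    | nil => simpa [run, headTransducer] using h1 v
    | cons b u ih => simpa [run, headTransducer] using ih
  rcases L with _ | ⟨u, L⟩
  · rfl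
  · exact (encodeStrings_singleton u).trans ((h2 u (encodeStrings L)).symm.trans
      (by rw [id, encodeStrings_cons]; rfl))

theorem PolyTime.tail {f : α → List (List Bool)} (hf : PolyTime ea id f) :
    PolyTime ea id fun a => (f a).tail :=
  hf.comp polyTime_tail

theorem PolyTime.getD {f : α → List (List Bool)} (hf : PolyTime ea id f) (j : ℕ) :
    PolyTime ea single fun a => (f a).getD j [] := by
  induction j generalizing f with
  | zero =>
    refine (hf.comp polyTime_head).congr_output fun a => ?_
    cases f a <;> rfl
  | succ j ih =>
    refine (ih hf.tail).congr_output fun a => ?_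
    cases f a <;> rfl

theorem polyTime_strings (ea : α → List (List Bool)) : PolyTime ea id ea :=
  PolyTime.congr_output (f := id) (eb := ea)
    ⟨Turing.idComputableInPolyTime fun a => encodeStrings (ea a)⟩ fun _ => rfl

/-- The `j`-th string of the input is computable in polynomial time. -/
theorem polyTime_getD (ea : α → List (List Bool)) (j : ℕ) :
    PolyTime ea single fun a => (ea a).getD j [] :=
  (polyTime_strings ea).getD j

theorem PolyTime.cons {f : α → List Bool} {g : α → List (List Bool)}
    (hf : PolyTime ea single f) (hg : PolyTime ea id g) : PolyTime ea id fun a => f a :: g a :=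
  (PolyTime.append (hf.congr_output (ec := id) (g := fun a => [f a]) fun _ => rfl) hg)

theorem PolyTime.toList {f : α → List Bool} (hf : PolyTime ea single f) :
    PolyTime ea id fun a => [f a] :=
  hf.congr_output fun _ => rfl

/-- Replaces each bit by `b`. -/
def replicateTransducer (b : Bool) : Transducer Unit where
  init := ()
  step
    | _, some _, _ => ((), [some b])
    | _, none, _ => ((), [none])
  final _ := []

theorem polyTime_replicate_length (b : Bool) :
    PolyTime single single fun w => List.replicate w.length b := by
  refine (replicateTransducer b).polyTime fun w => ?_
  simp only [encodeStrings_singleton]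
  induction w with
  | nil => simp [run, replicateTransducer]
  | cons c w ih => simpa [run, replicateTransducer, List.replicate_succ] using ih

theorem PolyTime.instance {f g h : α → List Bool} (hf : PolyTime ea single f)
    (hg : PolyTime ea single g) (hh : PolyTime ea single h) :
    PolyTime ea Instance.strings fun a => ⟨f a, (g a).length, h a⟩ :=
  (hf.cons ((hg.comp (polyTime_replicate_length false)).cons hh.toList)).congr_output
    fun _ => rfl

/-! ### Coding tuples of strings by strings -/

/-- The symbols coded by the pairs of consecutive bits of a string: `1b` stands for the bit `b`,
and `01` for the separator; `00` is padding. -/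
def symbols : List Bool → List Sym
  | true :: b :: w => some b :: symbols w
  | false :: true :: w => none :: symbols w
  | false :: false :: w => symbols w
  | _ => []

/-- Cut a sequence of symbols at the separators. -/
def split : List Sym → List (List Bool)
  | [] => [[]]
  | none :: v => [] :: split v
  | some b :: v => (b :: (split v).headD []) :: (split v).tail

/-- The tuple of strings coded by a string. Every string codes some tuple. -/
def decode (w : List Bool) : List (List Bool) := split (symbols w)

/-- Code of a symbol by two bits. -/
def codeSymbol : Sym → List Bool
  | some b => [true, b]
  | none => [false, true]

/-- Code of a nonempty tuple of strings by a string. The last separator is dropped, since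
`split` treats the end of a sequence as a separator, too. -/
def code (L : List (List Bool)) : List Bool := (encodeStrings L).dropLast.flatMap codeSymbol

theorem symbols_flatMap_codeSymbol (v : List Sym) (k : ℕ) :
    symbols (v.flatMap codeSymbol ++ List.replicate k false) = v := by
  induction v with
  | nil =>
    induction k using Nat.twoStepInduction with
    | zero => simp [symbols]
    | one => simp [symbols]
    | more k ih _ => simpa [symbols, List.replicate_succ] using ih
  | cons s v ih => rcases s with _ | b <;> simpa [codeSymbol, symbols] using ih

theorem split_encodeStrings {L : List (List Bool)} (hL : L ≠ []) :
    split (encodeStrings L).dropLast = L := by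
  induction L with
  | nil => exact absurd rfl hL
  | cons u L ih =>
    rcases L with _ | ⟨u', L⟩
    · rw [encodeStrings_singleton, List.dropLast_concat]
      induction u with
      | nil => rfl
      | cons b u ih => simp [split, ih]
    · have hne : none :: encodeStrings (u' :: L) ≠ [] := by simp
      have hne' : encodeStrings (u' :: L) ≠ [] := by simp [encodeStrings_cons]
      rw [encodeStrings_cons, List.dropLast_append_of_ne_nil hne, List.dropLast_cons_of_ne_nil hne']
      induction u with
      | nil => simpa [split] using ih (by simp)
      | cons b u ih' => simp [split, ih']

theorem decode_code {L : List (List Bool)} (hL : L ≠ []) (k : ℕ) :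
    decode (code L ++ List.replicate k false) = L := by
  rw [decode, code, symbols_flatMap_codeSymbol, split_encodeStrings hL]

theorem length_code_le (L : List (List Bool)) :
    (code L).length ≤ 2 * (encodeStrings L).length := by
  have h (v : List Sym) : (v.flatMap codeSymbol).length = 2 * v.length := by
    induction v with
    | nil => rfl
    | cons s v ih =>
      rw [List.flatMap_cons, List.length_append, ih, List.length_cons]
      rcases s with _ | b <;> simp [codeSymbol] <;> omega
  rw [code, h, List.length_dropLast]
  omega

theorem encodeStrings_split (v : List Sym) : encodeStrings (split v) = v ++ [none] := by
  have hne (v : List Sym) : split v = (split v).headD [] :: (split v).tail := by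
    rcases v with _ | ⟨_ | b, v⟩ <;> rfl
  induction v with
  | nil => rfl
  | cons s v ih =>
    rw [hne v, encodeStrings_cons] at ih
    rcases s with _ | b
    · rw [split, encodeStrings_cons, hne v, encodeStrings_cons, ih]; rfl
    · rw [split, encodeStrings_cons, List.map_cons, List.cons_append, ih]; rfl

/-- The state is the first bit of the current pair, if it has been read. -/
def decodeTransducer : Transducer (Option Bool) where
  init := none
  step
    | _, none, _ => (none, [])
    | none, some b, _ => (some b, [])
    | some true, some b, _ => (none, [some b])
    | some false, some true, _ => (none, [none])
    | some false, some false, _ => (none, [])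
  final _ := [none]

theorem polyTime_decode : PolyTime single id decode := by
  refine decodeTransducer.polyTime fun w => ?_
  rw [id, decode, encodeStrings_split, encodeStrings_singleton]
  induction w using symbols.induct with
  | case1 b w ih => simpa [symbols, decodeTransducer, run] using ih
  | case2 w ih => simpa [symbols, decodeTransducer, run] using ih
  | case3 w ih => simpa [symbols, decodeTransducer, run] using ih
  | case4 w h1 h2 h3 =>
    rcases w with _ | ⟨a, _ | ⟨b, w⟩⟩
    · simp [symbols, decodeTransducer, run]
    · cases a <;> simp [symbols, decodeTransducer, run]
    · cases a
      · cases b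
        · exact absurd rfl (h3 w)
        · exact absurd rfl (h2 w)
      · exact absurd rfl (h1 b w)

theorem PolyTime.decode {f : α → List Bool} (hf : PolyTime ea single f) :
    PolyTime ea id fun a => decode (f a) :=
  hf.comp polyTime_decode

/-! ### Prefixes and suffixes of given length, and matching of prefixes -/

/-- Keep the bits for which there is (`b = true`) or is not (`b = false`) a bit in the
register. -/
def takeTransducer (b : Bool) : Transducer Unit where
  init := ()
  step
    | _, none, _ => ((), [none])
    | _, some c, o => ((), if o.isSome = b then [some c] else [])
  final _ := []

/-- A pair of strings as a tuple. -/
abbrev pairStrings (x : List Bool × List Bool) : List (List Bool) := [x.1, x.2]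

theorem PolyTime.pair {f g : α → List Bool} (hf : PolyTime ea single f)
    (hg : PolyTime ea single g) : PolyTime ea pairStrings fun a => (f a, g a) :=
  (hf.cons hg.toList).congr_output fun _ => rfl

theorem takeTransducer_run (b : Bool) (u v : List Bool) :
    (takeTransducer b).run () u (v.map some ++ [none])
      = (if b then v.take u.length else v.drop u.length).map some ++ [none] := by
  induction v generalizing u with
  | nil => cases b <;> simp [run, takeTransducer]
  | cons c v ih =>
    have := ih u.tail
    rcases u with _ | ⟨d, u⟩ <;> cases b <;> simpa [run, takeTransducer] using this

theorem PolyTime.take {f g : α → List Bool} (hf : PolyTime ea single f)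
    (hg : PolyTime ea single g) : PolyTime ea single fun a => (g a).take (f a).length := by
  refine (hf.pair hg).comp (g := fun x => x.2.take x.1.length) ?_
  refine (takeTransducer true).polyTime_register (fun x => x.1) (fun x => [x.2]) (fun _ => rfl)
    fun x => ?_
  rw [encodeStrings_singleton, encodeStrings_singleton,
    show (takeTransducer true).init = () from rfl,
    takeTransducer_run]
  rfl

theorem PolyTime.drop {f g : α → List Bool} (hf : PolyTime ea single f)
    (hg : PolyTime ea single g) : PolyTime ea single fun a => (g a).drop (f a).length := by
  refine (hf.pair hg).comp (g := fun x => x.2.drop x.1.length) ?_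
  refine (takeTransducer false).polyTime_register (fun x => x.1) (fun x => [x.2]) (fun _ => rfl)
    fun x => ?_
  rw [encodeStrings_singleton, encodeStrings_singleton,
    show (takeTransducer false).init = () from rfl, takeTransducer_run]
  rfl

/-- If the first string of the tuple is a prefix of `r`, the other strings of the tuple. -/
def matchTag (r : List Bool) : List (List Bool) → List (List Bool)
  | [] => []
  | t :: L => if t <+: r then L else []

/-- State `none`: comparing; `some b`: the comparison had result `b`. -/
def matchTransducer : Transducer (Option Bool) where
  init := none
  step
    | none, some b, o => (if o = some b then none else some false, [])
    | none, none, _ => (some true, [])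
    | some true, s, _ => (some true, [s])
    | some false, _, _ => (some false, [])
  final _ := []

theorem PolyTime.matchTag {f : α → List Bool} {g : α → List (List Bool)}
    (hf : PolyTime ea single f) (hg : PolyTime ea id g) :
    PolyTime ea id fun a => matchTag (f a) (g a) := by
  refine ((hf.cons hg).congr_output (ec := fun x : List Bool × List (List Bool) => x.1 :: x.2)
    (g := fun a => (f a, g a)) fun _ => rfl).comp (g := fun x => RelAdvice.matchTag x.1 x.2) ?_
  refine matchTransducer.polyTime_register (fun x => x.1) (fun x => x.2) (fun _ => rfl) fun x => ?_
  have h1 (r : List Bool) (v : List Sym) : matchTransducer.run (some true) r v = v := by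
    induction v generalizing r with
    | nil => rfl
    | cons s v ih => simpa [run, matchTransducer] using ih r.tail
  have h2 (r : List Bool) (v : List Sym) : matchTransducer.run (some false) r v = [] := by
    induction v generalizing r with
    | nil => rfl
    | cons s v ih => simpa [run, matchTransducer] using ih r.tail
  have h3 (r t : List Bool) (v : List Sym) :
      matchTransducer.run none r (t.map some ++ none :: v) = if t <+: r then v else [] := by
    induction t generalizing r with
    | nil => simpa [run, matchTransducer] using h1 r.tail v
    | cons b t ih =>
      rcases r with _ | ⟨c, r⟩
      · simpa [run, matchTransducer] using h2 [] _
      · by_cases hbc : b = c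
        · subst hbc
          simpa [run, matchTransducer] using ih r
        · simpa [run, matchTransducer, hbc, Ne.symm hbc] using h2 r _
  obtain ⟨r, _ | ⟨t, L⟩⟩ := x
  · rfl
  · rw [encodeStrings_cons, show matchTransducer.init = none from rfl, h3, id, RelAdvice.matchTag]
    split_ifs <;> rfl

/-! ### Selection of an advice block by random bits -/

/-- An instance with a further string `r`. -/
abbrev withBits (zr : Instance × List Bool) : List (List Bool) := zr.1.strings ++ [zr.2]

theorem polyTime_withBits_x : PolyTime withBits single fun zr => zr.1.x :=
  polyTime_getD withBits 0

theorem polyTime_withBits_a : PolyTime withBits single fun zr => zr.1.a :=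
  polyTime_getD withBits 2

theorem polyTime_withBits_r : PolyTime withBits single fun zr => zr.2 :=
  polyTime_getD withBits 3

theorem PolyTime.withBits {f : α → Instance} {g : α → List Bool}
    (hf : PolyTime ea Instance.strings f) (hg : PolyTime ea single g) :
    PolyTime ea withBits fun a => (f a, g a) :=
  (PolyTime.append (hf.congr_output (ec := id) (g := fun a => (f a).strings) fun _ => rfl)
    hg.toList).congr_output fun _ => rfl

/-- The contents of those blocks in the list `us` whose tag is a prefix of `r`. -/
def selected (r : List Bool) (us : List (List Bool)) : List (List Bool) :=
  us.flatMap fun u => matchTag r (decode u)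

/-- The block of the advice selected by `r`. -/
def selection (zr : Instance × List Bool) : List (List Bool) :=
  selected zr.2 (decode zr.1.a).tail

/-- The instance to be solved with the selected advice. -/
def selectedInstance (zr : Instance × List Bool) : Instance :=
  ⟨zr.1.x, ((selection zr).getD 0 []).length, (selection zr).getD 1 []⟩

/-- What remains of `r` after as many bits as the selected block prescribes. -/
def selectedBits (zr : Instance × List Bool) : List Bool :=
  zr.2.drop ((selection zr).getD 2 []).length

theorem polyTime_selection : PolyTime withBits id selection := by
  refine PolyTime.flatMap (g := fun x => matchTag x.1 (decode x.2)) ?_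
    (polyTime_withBits_r.cons polyTime_withBits_a.decode.tail)
  exact PolyTime.matchTag (polyTime_getD pairStrings 0) (polyTime_getD pairStrings 1).decode

theorem polyTime_selectedInstance : PolyTime withBits Instance.strings selectedInstance :=
  polyTime_withBits_x.instance (polyTime_selection.getD 0) (polyTime_selection.getD 1)

theorem polyTime_selectedBits : PolyTime withBits single selectedBits :=
  (polyTime_selection.getD 2).drop polyTime_withBits_r

/-! ### Circuit descriptions -/

/-- For each string `v` of the tuple, the description of a Hadamard gate on qubit `|v|`. -/
def hadamardStrings (L : List (List Bool)) : List (List Bool) :=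
  L.flatMap fun v => [unary 0, unary v.length]

/-- The state says whether the symbol is preceded by a bit of the same string. -/
def hadamardTransducer : Transducer Bool where
  init := false
  step
    | false, some _, _ => (true, [none, some true])
    | false, none, _ => (false, [none, none])
    | true, some _, _ => (true, [some true])
    | true, none, _ => (false, [none])
  final _ := []

theorem polyTime_hadamardStrings : PolyTime id id hadamardStrings := by
  refine hadamardTransducer.polyTime fun L => ?_
  have h1 (u : List Bool) (v : List Sym) :
      hadamardTransducer.run true [] (u.map some ++ none :: v)
        = (unary u.length).map some ++ none :: hadamardTransducer.run false [] v := by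
    induction u with
    | nil => simp [run, hadamardTransducer, unary]
    | cons b u ih =>
      simp only [List.map_cons, List.cons_append, run, List.tail_nil,
        hadamardTransducer, List.length_cons, unary, List.replicate_succ] at ih ⊢
      rw [ih]; rfl
  induction L with
  | nil => rfl
  | cons u L ih =>
    simp only [id, hadamardTransducer] at ih h1 ⊢
    rw [hadamardStrings, List.flatMap_cons, ← hadamardStrings, encodeStrings_append, ih,
      encodeStrings_cons, encodeStrings_cons, encodeStrings_cons, encodeStrings_nil]
    rcases u with _ | ⟨b, u⟩
    · simp [run, unary]
    · have := h1 u (encodeStrings L)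
      simp only [List.map_cons, List.cons_append, run, List.tail_nil]
      rw [this]
      simp [unary, List.replicate_succ]

/-- The total number of bits in a tuple of strings. -/
def bits (L : List (List Bool)) : ℕ := (L.map List.length).sum

/-- Drops all separators, and ends with one more bit and a separator. -/
def bitsTransducer : Transducer Unit where
  init := ()
  step
    | _, some _, _ => ((), [some true])
    | _, none, _ => ((), [])
  final _ := [some true, none]

theorem polyTime_bits : PolyTime id single fun L => unary (bits L + 1) := by
  refine bitsTransducer.polyTime fun L => ?_
  have h1 (u : List Bool) (v : List Sym) : bitsTransducer.run () [] (u.map some ++ none :: v)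
      = List.replicate u.length (some true) ++ bitsTransducer.run () [] v := by
    induction u with
    | nil => simp [run, bitsTransducer]
    | cons b u ih =>
      simp only [List.map_cons, List.cons_append, run, List.tail_nil,
        bitsTransducer, List.length_cons, List.replicate_succ] at ih ⊢
      rw [ih]; rfl
  rw [encodeStrings_singleton]
  induction L with
  | nil => rfl
  | cons u L ih =>
    have e : bits (u :: L) = u.length + bits L := by simp [bits]
    simp only [id, show bitsTransducer.init = () from rfl] at ih h1 ⊢
    rw [encodeStrings_cons, h1, ← ih, e]
    simp [unary, add_assoc, List.replicate_add]

/-- The description of a gate, with strings for qubits marked by a final `0`. -/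
def Gate.marked {N : ℕ} : Gate N → List (List Bool)
  | .hadamard i => [unary 0, unary i ++ [false]]
  | .phaseT i => [unary 1, unary i ++ [false]]
  | .cnot c t _ => [unary 2, unary c ++ [false], unary t ++ [false]]

/-- States: `0` reading the number of qubits; `1`, `2`, `3` reading a tag that starts with
0, 1, 2 ones; `4`, `5` one and two qubits to be read. -/
def markTransducer : Transducer (Fin 6) where
  init := 0
  step
    | 0, some _, _ => (0, [])
    | 0, none, _ => (1, [])
    | 1, some _, _ => (2, [some true])
    | 1, none, _ => (4, [none])
    | 2, some _, _ => (3, [some true])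
    | 2, none, _ => (4, [none])
    | 3, some _, _ => (3, [some true])
    | 3, none, _ => (5, [none])
    | 4, some _, _ => (4, [some true])
    | 4, none, _ => (1, [some false, none])
    | 5, some _, _ => (5, [some true])
    | 5, none, _ => (4, [some false, none])
  final _ := []

theorem polyTime_marked : PolyTime Circuit.strings id fun C => C.gates.flatMap Gate.marked := by
  refine markTransducer.polyTime fun C => ?_
  have h0 (n : ℕ) (v : List Sym) : markTransducer.run 0 [] ((unary n).map some ++ none :: v)
      = markTransducer.run 1 [] v := by
    induction n with
    | zero => simp [run, markTransducer, unary]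
    | succ n ih => simpa [run, markTransducer, unary, List.replicate_succ] using ih
  have h4 (n : ℕ) (v : List Sym) : markTransducer.run 4 [] ((unary n).map some ++ none :: v)
      = (unary n).map some ++ some false :: none :: markTransducer.run 1 [] v := by
    induction n with
    | zero => simp [run, markTransducer, unary]
    | succ n ih => simpa [run, markTransducer, unary, List.replicate_succ] using ih
  have h5 (n : ℕ) (v : List Sym) : markTransducer.run 5 [] ((unary n).map some ++ none :: v)
      = (unary n).map some ++ some false :: none :: markTransducer.run 4 [] v := by
    induction n with
    | zero => simp [run, markTransducer, unary]
    | succ n ih => simpa [run, markTransducer, unary, List.replicate_succ] using ih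
  have hg {N : ℕ} (l : List (Gate N)) : encodeStrings (l.flatMap Gate.marked)
      = markTransducer.run 1 [] (encodeStrings (l.flatMap Gate.strings)) := by
    induction l with
    | nil => rfl
    | cons g l ih =>
      rw [List.flatMap_cons, List.flatMap_cons, encodeStrings_append, encodeStrings_append, ih]
      cases g with
      | hadamard i =>
        have := h4 i (encodeStrings (l.flatMap Gate.strings))
        simp only [Gate.strings, Gate.marked, encodeStrings_cons, encodeStrings_nil]
        simp [unary, run, markTransducer] at this ⊢
        exact this.symm
      | phaseT i =>
        have := h4 i (encodeStrings (l.flatMap Gate.strings))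
        simp only [Gate.strings, Gate.marked, encodeStrings_cons, encodeStrings_nil]
        simp [unary, run, markTransducer] at this ⊢
        exact this.symm
      | cnot c t h =>
        have h1 := h4 t (encodeStrings (l.flatMap Gate.strings))
        have h2 := h5 c ((unary t).map some ++ none :: encodeStrings (l.flatMap Gate.strings))
        rw [h1] at h2
        simp only [Gate.strings, Gate.marked, encodeStrings_cons, encodeStrings_nil]
        simp [unary, run, markTransducer, List.replicate_succ] at h2 ⊢
        exact h2.symm
  rw [id, hg, Circuit.strings, encodeStrings_cons, show markTransducer.init = 0 from rfl, h0]

/-- Add the length of `c` to a marked string; leave an unmarked string alone. -/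
def shiftString (c u : List Bool) : List Bool :=
  u.takeWhile (· = true) ++ if false ∈ u then unary c.length else []

/-- States: `0` first string, no mark so far; `1` mark found; `2` second string to be
copied; `3` second string to be skipped. -/
def shiftTransducer : Transducer (Fin 4) where
  init := 0
  step
    | 0, some true, _ => (0, [some true])
    | 0, some false, _ => (1, [])
    | 0, none, _ => (3, [none])
    | 1, some _, _ => (1, [])
    | 1, none, _ => (2, [])
    | 2, some _, _ => (2, [some true])
    | 2, none, _ => (2, [none])
    | 3, _, _ => (3, [])
  final _ := []

theorem polyTime_shiftString : PolyTime pairStrings id fun x => [shiftString x.1 x.2] := by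
  refine PolyTime.comp (f := fun x : List Bool × List Bool => (x.2, x.1)) (eb := pairStrings)
    (g := fun x => [shiftString x.2 x.1])
    ((polyTime_getD pairStrings 1).pair (polyTime_getD pairStrings 0)) ?_
  refine shiftTransducer.polyTime fun x => ?_
  obtain ⟨u, c⟩ := x
  have h3 (v : List Sym) : shiftTransducer.run 3 [] v = [] := by
    induction v with
    | nil => rfl
    | cons s v ih => simpa [run, shiftTransducer] using ih
  have h2 (c : List Bool) : shiftTransducer.run 2 [] (c.map some ++ [none])
      = (unary c.length).map some ++ [none] := by
    induction c with
    | nil => simp [run, shiftTransducer, unary]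
    | cons b c ih => simpa [run, shiftTransducer, unary, List.replicate_succ] using ih
  have h1 (u c : List Bool) :
      shiftTransducer.run 1 [] (u.map some ++ none :: (c.map some ++ [none]))
      = (unary c.length).map some ++ [none] := by
    induction u with
    | nil => simpa [run, shiftTransducer] using h2 c
    | cons b u ih => simpa [run, shiftTransducer] using ih
  simp only [encodeStrings_cons, encodeStrings_nil, id, show shiftTransducer.init = 0 from rfl]
  induction u with
  | nil => simpa [run, shiftTransducer, shiftString] using h3 _
  | cons b u ih =>
    rcases b
    · simpa [run, shiftTransducer, shiftString] using (h1 u c).symm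
    · simpa [run, shiftTransducer, shiftString] using ih

/-! ### Running the circuits of all advice blocks in parallel -/

/-- The instance with input `x` and the error parameter and the advice of block `u`. -/
def blockInstance (x u : List Bool) : Instance :=
  ⟨x, ((decode u).getD 1 []).length, (decode u).getD 2 []⟩

/-- The first qubit for the circuit of block `u`. -/
def blockOffset (u : List Bool) : ℕ := ((decode u).getD 3 []).length

/-- A gate with a number of qubits that is still to be determined. -/
inductive RawGate where
  | hadamard (i : ℕ)
  | phaseT (i : ℕ)
  | cnot (c t : ℕ) (hct : c ≠ t)

namespace RawGate

/-- Description of a gate, as for `Gate.strings`. -/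
def strings : RawGate → List (List Bool)
  | .hadamard i => [unary 0, unary i]
  | .phaseT i => [unary 1, unary i]
  | .cnot c t _ => [unary 2, unary c, unary t]

/-- The gate on `N` qubits, if `N` is large enough. -/
def toGate (N : ℕ) : RawGate → Option (Gate N)
  | .hadamard i => if h : i < N then some (.hadamard ⟨i, h⟩) else none
  | .phaseT i => if h : i < N then some (.phaseT ⟨i, h⟩) else none
  | .cnot c t hct => if h : c < N ∧ t < N then
      some (.cnot ⟨c, h.1⟩ ⟨t, h.2⟩ fun e => hct (congrArg Fin.val e)) else none

theorem toGate_of_bits_lt {N : ℕ} (g : RawGate) (h : bits g.strings < N) :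
    ∃ g', g.toGate N = some g' ∧ g'.strings = g.strings := by
  cases g with
  | hadamard i =>
    have h : i < N := by simp [bits, strings, unary] at h; omega
    exact ⟨_, dif_pos h, rfl⟩
  | phaseT i =>
    have h : i < N := by simp [bits, strings, unary] at h; omega
    exact ⟨_, dif_pos h, rfl⟩
  | cnot c t hct =>
    have h : c < N ∧ t < N := by simp [bits, strings, unary] at h; omega
    exact ⟨_, dif_pos h, rfl⟩

end RawGate

/-- Move a gate by `k` qubits. -/
def Gate.shift (k : ℕ) {N : ℕ} : Gate N → RawGate
  | .hadamard i => .hadamard (i + k)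
  | .phaseT i => .phaseT (i + k)
  | .cnot c t hct => .cnot (c + k) (t + k) (by rwa [ne_eq, add_left_inj, Fin.val_inj])

theorem shiftString_unary (c : List Bool) (n : ℕ) : shiftString c (unary n) = unary n := by
  have h : false ∉ unary n := by simp [unary]
  simp only [shiftString, h, if_false, List.append_nil]
  simp [unary]

theorem shiftString_mark (c : List Bool) (n : ℕ) :
    shiftString c (unary n ++ [false]) = unary (n + c.length) := by
  simp only [shiftString, List.mem_append, List.mem_singleton, or_true, if_true]
  rw [List.takeWhile_append_of_pos (by simp [unary])]
  simp only [unary, List.takeWhile_cons, Bool.false_eq_true, decide_false, List.append_nil,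
    List.replicate_append_replicate, if_false]

theorem flatMap_shiftString_marked (c : List Bool) {N : ℕ} (g : Gate N) :
    g.marked.flatMap (fun s => [shiftString c s]) = (g.shift c.length).strings := by
  cases g <;> simp [Gate.marked, shiftString_unary, shiftString_mark, Gate.shift, RawGate.strings]

section Parallel

variable (Q : Instance → Circuit)

/-- The gates of the circuit for block `u`. -/
def blockGates (x u : List Bool) : List RawGate :=
  (Q (blockInstance x u)).gates.map (Gate.shift (blockOffset u))

/-- Hadamard gates, as many as the first string of the advice prescribes, and then the circuits
of all blocks. -/
def parallelGates (z : Instance) : List RawGate :=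
  (decode ((decode z.a).headD [])).map (fun v => .hadamard v.length) ++
    (decode z.a).tail.flatMap (blockGates Q z.x)

/-- The number of qubits is chosen to be large enough for all gates, whatever the advice is, and
at least the length of the advice. -/
def parallelCircuit (z : Instance) : Circuit where
  N := bits ((parallelGates Q z).flatMap RawGate.strings ++ [z.a]) + 1
  gates := (parallelGates Q z).filterMap (RawGate.toGate _)

theorem bits_append (K L : List (List Bool)) : bits (K ++ L) = bits K + bits L := by
  simp [bits]

theorem parallelCircuit_strings (z : Instance) : (parallelCircuit Q z).strings =
    unary (bits ((parallelGates Q z).flatMap RawGate.strings ++ [z.a]) + 1) ::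
      (parallelGates Q z).flatMap RawGate.strings := by
  have h (N : ℕ) (l : List RawGate) (hl : bits (l.flatMap RawGate.strings) < N) :
      (l.filterMap (RawGate.toGate N)).flatMap Gate.strings = l.flatMap RawGate.strings := by
    induction l with
    | nil => rfl
    | cons g l ih =>
      rw [List.flatMap_cons, bits_append] at hl
      obtain ⟨g', h1, h2⟩ := RawGate.toGate_of_bits_lt (N := N) g (by omega)
      rw [List.filterMap_cons_some h1, List.flatMap_cons, List.flatMap_cons, h2, ih (by omega)]
  rw [Circuit.strings]
  congr 1
  exact h _ _ (by simp only [parallelCircuit, bits_append]; omega)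

variable {Q}

theorem polyTime_parallelCircuit (hQ : PolyTime Instance.strings Circuit.strings Q) :
    PolyTime Instance.strings Circuit.strings (parallelCircuit Q) := by
  have hx : PolyTime Instance.strings single fun z => z.x := polyTime_getD Instance.strings 0
  have ha : PolyTime Instance.strings single fun z => z.a := polyTime_getD Instance.strings 2
  have hu : PolyTime pairStrings id fun y => decode y.2 := (polyTime_getD pairStrings 1).decode
  have hC : PolyTime pairStrings id fun y =>
      (Q (blockInstance y.1 y.2)).gates.flatMap Gate.marked :=
    (((polyTime_getD pairStrings 0).instance (hu.getD 1) (hu.getD 2)).comp hQ).comp polyTime_marked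
  have hB : PolyTime pairStrings id fun y => (blockGates Q y.1 y.2).flatMap RawGate.strings := by
    refine (PolyTime.flatMap polyTime_shiftString ((hu.getD 3).cons hC)).congr_output fun y => ?_
    simp only [blockGates, List.flatMap_assoc, id, flatMap_shiftString_marked, List.flatMap_map]
    rfl
  have hG : PolyTime Instance.strings id fun z =>
      (parallelGates Q z).flatMap RawGate.strings := by
    refine (PolyTime.append ((ha.decode.comp polyTime_head).decode.comp polyTime_hadamardStrings)
      (PolyTime.flatMap hB (hx.cons ha.decode.tail))).congr_output fun z => ?_
    simp only [parallelGates, List.flatMap_append, List.flatMap_assoc, List.flatMap_map, id]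
    rfl
  exact (((hG.append ha.toList).comp polyTime_bits).cons hG).congr_output fun z =>
    (parallelCircuit_strings Q z).symm

end Parallel

/-! ### Circuits acting on disjoint sets of qubits -/

/-- Rename the qubits on which a gate acts. -/
def Gate.map {M N : ℕ} (e : Fin M ↪ Fin N) : Gate M → Gate N
  | .hadamard i => .hadamard (e i)
  | .phaseT i => .phaseT (e i)
  | .cnot c t hct => .cnot (e c) (e t) (e.injective.ne hct)

/-- The action of a list of gates. -/
def applyGates {N : ℕ} (l : List (Gate N)) (ψ : (Fin N → Bool) → ℂ) : (Fin N → Bool) → ℂ :=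
  l.foldl (fun ψ g => g.apply ψ) ψ

theorem applyGates_append {N : ℕ} (k l : List (Gate N)) (ψ : (Fin N → Bool) → ℂ) :
    applyGates (k ++ l) ψ = applyGates l (applyGates k ψ) :=
  List.foldl_append

theorem flipBit_comp {M N : ℕ} (e : Fin M ↪ Fin N) (i : Fin M) (b : Fin N → Bool) :
    flipBit (e i) b ∘ e = flipBit i (b ∘ e) :=
  update_comp_eq_of_injective b e.injective i _

/-- A gate that acts on some of the qubits leaves alone a factor `χ` that does not depend on these
qubits. -/
theorem Gate.map_apply {M N : ℕ} (e : Fin M ↪ Fin N) (g : Gate M) (φ : (Fin M → Bool) → ℂ)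
    (χ : (Fin N → Bool) → ℂ) (hχ : ∀ i b, χ (flipBit (e i) b) = χ b) :
    (g.map e).apply (fun b => φ (b ∘ e) * χ b) = fun b => g.apply φ (b ∘ e) * χ b := by
  funext b
  cases g with
  | hadamard i =>
    simp only [Gate.map, Gate.apply, flipBit_comp, hχ, comp_apply]
    ring
  | phaseT i =>
    simp only [Gate.map, Gate.apply, comp_apply]
    ring
  | cnot c t hct =>
    simp only [Gate.map, Gate.apply, comp_apply]
    split_ifs
    · rw [flipBit_comp, hχ]
    · rfl

theorem applyGates_map {M N : ℕ} (e : Fin M ↪ Fin N) (l : List (Gate M)) (φ : (Fin M → Bool) → ℂ)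
    (χ : (Fin N → Bool) → ℂ) (hχ : ∀ i b, χ (flipBit (e i) b) = χ b) :
    applyGates (l.map (Gate.map e)) (fun b => φ (b ∘ e) * χ b)
      = fun b => applyGates l φ (b ∘ e) * χ b := by
  induction l generalizing φ with
  | nil => rfl
  | cons g l ih =>
    simp only [List.map_cons, applyGates, List.foldl_cons] at ih ⊢
    rw [Gate.map_apply e g φ χ hχ, ih]

section Disjoint

variable {ι : Type} {n : ι → ℕ} {N : ℕ} (e : (Σ i, Fin (n i)) ↪ Fin N)

/-- The inclusion of the qubits of block `i`. -/
def blockEmb (i : ι) : Fin (n i) ↪ Fin N :=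
  (Embedding.sigmaMk i).trans e

/-- The qubits outside of all blocks are zero. -/
def ZeroOutside (b : Fin N → Bool) : Prop := ∀ j ∉ Set.range e, b j = false

theorem zeroOutside_flipBit (x : Σ i, Fin (n i)) (b : Fin N → Bool) :
    ZeroOutside e (flipBit (e x) b) ↔ ZeroOutside e b := by
  refine forall₂_congr fun j hj => ?_
  rw [flipBit, update_of_ne]
  rintro rfl
  exact hj ⟨x, rfl⟩

theorem flipBit_comp_blockEmb {i k : ι} (h : k ≠ i) (a : Fin (n i)) (b : Fin N → Bool) :
    flipBit (blockEmb e i a) b ∘ blockEmb e k = b ∘ blockEmb e k := by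
  funext c
  refine update_of_ne (fun hc => h ?_) _ _
  exact congrArg Sigma.fst (e.injective hc)

variable [Fintype ι]

open scoped Classical in
/-- Lists of gates on disjoint blocks of qubits transform product states into product states. -/
theorem applyGates_flatMap (g : ∀ i, List (Gate (n i))) (l : List ι) (hl : l.Nodup)
    (φ : ∀ i, (Fin (n i) → Bool) → ℂ) :
    applyGates (l.flatMap fun i => (g i).map (Gate.map (blockEmb e i)))
        (fun b => (∏ i, φ i (b ∘ blockEmb e i)) * if ZeroOutside e b then 1 else 0)
      = fun b => (∏ i, (if i ∈ l then applyGates (g i) (φ i) else φ i) (b ∘ blockEmb e i)) *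
        if ZeroOutside e b then 1 else 0 := by
  induction l generalizing φ with
  | nil => rfl
  | cons k l ih =>
    rw [List.nodup_cons] at hl
    have h (θ : ∀ i, (Fin (n i) → Bool) → ℂ) (b : Fin N → Bool) :
        (∏ i, θ i (b ∘ blockEmb e i)) * (if ZeroOutside e b then 1 else 0) =
          θ k (b ∘ blockEmb e k) * ((∏ i ∈ Finset.univ.erase k, θ i (b ∘ blockEmb e i)) *
            if ZeroOutside e b then 1 else 0) := by
      rw [← Finset.mul_prod_erase _ _ (Finset.mem_univ k), mul_assoc]
    rw [List.flatMap_cons, applyGates_append]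
    simp_rw [h φ]
    rw [applyGates_map]
    · have h2 := ih hl.2 (update φ k (applyGates (g k) (φ k)))
      simp_rw [h (update φ k _), update_self] at h2
      have h3 (b : Fin N → Bool) :
          ∏ i ∈ Finset.univ.erase k, update φ k (applyGates (g k) (φ k)) i (b ∘ blockEmb e i)
            = ∏ i ∈ Finset.univ.erase k, φ i (b ∘ blockEmb e i) :=
        Finset.prod_congr rfl fun i hi => by rw [update_of_ne (Finset.ne_of_mem_erase hi)]
      simp_rw [h3] at h2
      rw [h2]
      funext b
      congr 1
      refine Finset.prod_congr rfl fun i _ => ?_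
      by_cases hi : i = k
      · subst hi
        simp [hl.1]
      · simp [hi]
    · intro a b
      congr 1
      · refine Finset.prod_congr rfl fun i hi => ?_
        rw [flipBit_comp_blockEmb e (Finset.ne_of_mem_erase hi)]
      · have := zeroOutside_flipBit e ⟨k, a⟩ b
        exact if_congr this rfl rfl

open scoped Classical in
/-- The initial basis state is a product state. -/
theorem single_eq_prod (b : Fin N → Bool) :
    (Pi.single (fun _ => false) 1 : (Fin N → Bool) → ℂ) b =
      (∏ i, (Pi.single (fun _ => false) 1 : (Fin (n i) → Bool) → ℂ) (b ∘ blockEmb e i)) *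
        if ZeroOutside e b then 1 else 0 := by
  by_cases hb : b = fun _ => false
  · subst hb
    rw [if_pos (show ZeroOutside e _ from fun _ _ => rfl), Pi.single_eq_same, mul_one,
      Finset.prod_eq_one]
    intro i _
    exact Pi.single_eq_same (M := fun _ => ℂ) _ _
  · rw [Pi.single_eq_of_ne hb, eq_comm, mul_eq_zero, Finset.prod_eq_zero_iff]
    by_contra! h
    refine hb (funext fun j => ?_)
    by_cases hj : j ∈ Set.range e
    · obtain ⟨⟨i, a⟩, rfl⟩ := hj
      have h1 := h.1 i (Finset.mem_univ i)
      by_contra h2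
      refine h1 (Pi.single_eq_of_ne (M := fun _ => ℂ) (fun h3 => h2 ?_) _)
      exact congrFun h3 a
    · by_contra h2
      exact h.2 (if_neg fun h3 => h2 (h3 j hj))

open scoped Classical in
/-- Summation over all assignments of bits to the qubits, factored into the blocks. -/
theorem sum_prod_blockEmb (F : ∀ i, (Fin (n i) → Bool) → ℝ) :
    ∑ b : Fin N → Bool, (∏ i, F i (b ∘ blockEmb e i)) * (if ZeroOutside e b then 1 else 0)
      = ∏ i, ∑ v, F i v := by
  rw [Finset.prod_univ_sum, Fintype.piFinset_univ]
  have h (v : ∀ i, Fin (n i) → Bool) (i : ι) :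
      extend e (fun x : Σ i, Fin (n i) => v x.1 x.2) (fun _ => false) ∘ blockEmb e i = v i := by
    funext a
    exact e.injective.extend_apply _ _ (⟨i, a⟩ : Σ i, Fin (n i))
  refine (Fintype.sum_of_injective
    (fun v : ∀ i, Fin (n i) → Bool => extend e (fun x => v x.1 x.2) fun _ => false)
    (fun v w hvw => ?_) _ _ (fun b hb => ?_) (fun v => ?_)).symm
  · funext i
    rw [← h v i, ← h w i]
    exact congrArg (· ∘ blockEmb e i) hvw
  · rw [if_neg, mul_zero]
    refine fun h0 => hb ⟨fun i => b ∘ blockEmb e i, funext fun j => ?_⟩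
    by_cases hj : j ∈ Set.range e
    · obtain ⟨x, rfl⟩ := hj
      exact e.injective.extend_apply _ _ x
    · exact (extend_apply' _ _ _ hj).trans (h0 j hj).symm
  · rw [if_pos, mul_one]
    · exact Finset.prod_congr rfl fun i _ => by rw [h v i]
    · exact fun j hj => extend_apply' _ _ _ hj

end Disjoint

/-! ### Preparation of a uniformly random tag -/

/-- The circuit that applies a Hadamard gate to each of `l` qubits. -/
def uniformCircuit (l : ℕ) : Circuit := ⟨l, (List.finRange l).map .hadamard⟩

/-- Hadamard gates on distinct qubits create the uniform superposition on these qubits. -/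
theorem applyGates_hadamard {l : ℕ} (s : List (Fin l)) (hs : s.Nodup) :
    applyGates (s.map .hadamard) (Pi.single (fun _ => false) 1) = fun b =>
      if ∀ i ∉ s, b i = false then ((Real.sqrt 2 : ℝ) : ℂ)⁻¹ ^ s.length else 0 := by
  induction s using List.reverseRecOn with
  | nil =>
    funext b
    have h : (∀ i ∉ ([] : List (Fin l)), b i = false) ↔ b = fun _ => false := by
      simp [funext_iff]
    simp only [applyGates, List.map_nil, List.foldl_nil, List.length_nil, pow_zero, h,
      Pi.single_apply]
  | append_singleton s i ih =>
    rw [List.nodup_append] at hs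
    have hi : i ∉ s := fun h => hs.2.2 i h i (by simp) rfl
    rw [List.map_append, applyGates_append, ih hs.1]
    funext b
    have h1 : (∀ j ∉ s, b j = false) ↔ b i = false ∧ ∀ j ∉ s ++ [i], b j = false := by
      constructor
      · exact fun h => ⟨h i hi, fun j hj => h j fun h' => hj (by simp [h'])⟩
      · rintro ⟨h, h'⟩ j hj
        by_cases hji : j = i
        · rwa [hji]
        · exact h' j (by simp [hj, hji])
    have h2 : (∀ j ∉ s, flipBit i b j = false) ↔ b i = true ∧ ∀ j ∉ s ++ [i], b j = false := by
      constructor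
      · refine fun h => ⟨by simpa [flipBit] using h i hi, fun j hj => ?_⟩
        have := h j fun h' => hj (by simp [h'])
        rwa [flipBit, update_of_ne] at this
        rintro rfl
        simp at hj
      · rintro ⟨h, h'⟩ j hj
        by_cases hji : j = i
        · simp [hji, flipBit, h]
        · rw [flipBit, update_of_ne hji]
          exact h' j (by simp [hj, hji])
    simp only [applyGates, List.map_cons, List.map_nil, List.foldl_cons, List.foldl_nil,
      Gate.apply, h1, h2]
    cases hb : b i <;> simp [pow_succ']

theorem normSq_uniformCircuit (l : ℕ) (b : Fin l → Bool) :
    Complex.normSq ((uniformCircuit l).finalState b) = (1 / 2) ^ l := by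
  have h := congrFun (applyGates_hadamard (List.finRange l) (List.nodup_finRange l)) b
  have h' : (uniformCircuit l).finalState b = ((Real.sqrt 2 : ℝ) : ℂ)⁻¹ ^ l := by
    refine h.trans ?_
    simp
  rw [h', map_pow, map_inv₀, Complex.normSq_ofReal, Real.mul_self_sqrt (by norm_num), one_div]

/-! ### Measurement of circuits run in parallel -/

open scoped Classical in
theorem prob_map_outcome {β : Type} (C : Circuit) (f : (Fin C.N → Bool) → β) (E : Set β) :
    prob (C.outcome.map f) E
      = ∑ b, Complex.normSq (C.finalState b) * if f b ∈ E then 1 else 0 := by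
  rw [prob, PMF.toOuterMeasure_map_apply, PMF.toOuterMeasure_apply_fintype,
    ENNReal.toReal_sum]
  · refine Finset.sum_congr rfl fun b _ => ?_
    by_cases h : f b ∈ E
    · rw [Set.indicator_of_mem (by exact h), if_pos h, mul_one]
      exact ENNReal.toReal_ofReal (Complex.normSq_nonneg _)
    · rw [Set.indicator_of_notMem (by exact h), if_neg h, mul_zero, ENNReal.toReal_zero]
  · intro b _
    by_cases h : f b ∈ E
    · rw [Set.indicator_of_mem (by exact h)]
      exact PMF.apply_ne_top _ _
    · rw [Set.indicator_of_notMem (by exact h)]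
      exact ENNReal.zero_ne_top

/-- The block of the random tag, and one block for each tag. -/
def blockCircuit {l : ℕ} (C : (Fin l → Bool) → Circuit) : Option (Fin l → Bool) → Circuit
  | none => uniformCircuit l
  | some t => C t

open scoped Classical in
/-- If a uniformly random tag is prepared in one block and a circuit `C t` is run for each tag `t`
in a block of its own, and if the output depends only on the measured tag and on the measured bits
in the block of this tag, then the output is distributed as that of `C t` for a uniformly
random `t`. -/
theorem prob_parallel {β : Type} {l : ℕ} (C : (Fin l → Bool) → Circuit) (D : Circuit)
    (e : (Σ i, Fin (blockCircuit C i).N) ↪ Fin D.N) (s : List (Option (Fin l → Bool)))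
    (hs : s.Nodup) (hs' : ∀ i, i ∈ s)
    (hD : D.gates = s.flatMap fun i => (blockCircuit C i).gates.map (Gate.map (blockEmb e i)))
    (f : (Fin D.N → Bool) → β) (g : ∀ t, (Fin (C t).N → Bool) → β)
    (hf : ∀ (t : Fin l → Bool) b, b ∘ blockEmb e none = t → f b = g t (b ∘ blockEmb e (some t)))
    (E : Set β) :
    prob (D.outcome.map f) E = (1 / 2) ^ l * ∑ t, prob ((C t).outcome.map (g t)) E := by
  let φ (i) (v : Fin (blockCircuit C i).N → Bool) : ℝ :=
    Complex.normSq ((blockCircuit C i).finalState v)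
  have hst (b : Fin D.N → Bool) : Complex.normSq (D.finalState b)
      = (∏ i, φ i (b ∘ blockEmb e i)) * if ZeroOutside e b then 1 else 0 := by
    have h1 : D.finalState = fun b =>
        (∏ i, (blockCircuit C i).finalState (b ∘ blockEmb e i)) *
          if ZeroOutside e b then 1 else 0 := by
      have h2 := applyGates_flatMap e (fun i => (blockCircuit C i).gates) s hs
        fun i => Pi.single (fun _ => false) 1
      simp only [hs', if_true] at h2
      rw [Circuit.finalState, hD, funext (single_eq_prod e)]
      exact h2
    rw [h1, map_mul, map_prod]
    split_ifs <;> simp [φ]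
  have hφ (i) : ∑ v, φ i v = 1 := (blockCircuit C i).sum_normSq_finalState
  -- Fix the tag `t`, and put the indicator of the event into the factor of block `t`.
  let F (t : Fin l → Bool) : ∀ i, (Fin (blockCircuit C i).N → Bool) → ℝ
    | none => fun v => φ none v * if v = t then 1 else 0
    | some s => fun v => φ (some s) v * if s = t then if g s v ∈ E then 1 else 0 else 1
  have hF (t : Fin l → Bool) : ∏ i, ∑ v, F t i v
      = (1 / 2) ^ l * prob ((C t).outcome.map (g t)) E := by
    rw [Fintype.prod_option, prob_map_outcome]
    congr 1
    · exact (Fintype.sum_eq_single (t : Fin (uniformCircuit l).N → Bool)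
        fun v hv => mul_eq_zero_of_right _ (if_neg hv)).trans
        (((congrArg (_ * ·) (if_pos rfl)).trans (mul_one _)).trans (normSq_uniformCircuit l t))
    · rw [Fintype.prod_eq_single t]
      · refine Finset.sum_congr rfl fun v _ => ?_
        simp only [F, if_true]; rfl
      · intro s hs
        simp only [F, if_neg hs, mul_one]
        exact hφ (some s)
  rw [prob_map_outcome, Finset.mul_sum]
  simp_rw [← hF, ← sum_prod_blockEmb e]
  rw [Finset.sum_comm]
  refine Finset.sum_congr rfl fun b _ => ?_
  rw [← Finset.sum_mul, hst, mul_right_comm]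
  congr 1
  let t : Fin l → Bool := b ∘ blockEmb e none
  refine Eq.trans ?_ (Fintype.sum_eq_single t fun s hs => ?_).symm
  · rw [Fintype.prod_option, Fintype.prod_option]
    simp only [F, Finset.prod_mul_distrib]
    rw [mul_assoc]
    refine congrArg₂ _ ?_ (congrArg _ ?_)
    · exact ((congrArg (_ * ·) (if_pos rfl)).trans (mul_one _)).symm
    · rw [Fintype.prod_eq_single t fun s hs => if_neg hs, if_pos rfl, hf t b rfl]
      rfl
  · rw [Fintype.prod_option]
    exact mul_eq_zero_of_left (mul_eq_zero_of_right _ (if_neg (Ne.symm hs))) _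

/-! ### Probabilities of events -/

theorem prob_nonneg {α : Type} (μ : PMF α) (E : Set α) : 0 ≤ prob μ E := ENNReal.toReal_nonneg

theorem toOuterMeasure_le_one {α : Type} (μ : PMF α) (E : Set α) : μ.toOuterMeasure E ≤ 1 := by
  rw [PMF.toOuterMeasure_apply]
  exact (ENNReal.tsum_le_tsum (Set.indicator_le_self E μ)).trans μ.tsum_coe.le

theorem prob_le_one {α : Type} (μ : PMF α) (E : Set α) : prob μ E ≤ 1 :=
  ENNReal.toReal_le_of_le_ofReal zero_le_one (by simpa using toOuterMeasure_le_one μ E)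

open scoped Classical in
theorem prob_pure {α : Type} (a : α) (E : Set α) :
    prob (PMF.pure a) E = if a ∈ E then 1 else 0 := by
  rw [prob, PMF.toOuterMeasure_pure_apply]
  split_ifs <;> simp

theorem prob_bind {α β : Type} [Fintype α] (μ : PMF α) (f : α → PMF β) (E : Set β) :
    prob (μ.bind f) E = ∑ a, (μ a).toReal * prob (f a) E := by
  rw [prob, PMF.toOuterMeasure_bind_apply, tsum_fintype, ENNReal.toReal_sum]
  · exact Finset.sum_congr rfl fun a _ => ENNReal.toReal_mul
  · exact fun a _ => ENNReal.mul_ne_top (μ.apply_ne_top a)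
      ((toOuterMeasure_le_one _ _).trans_lt ENNReal.one_lt_top).ne

theorem sum_toReal {α : Type} [Fintype α] (μ : PMF α) : ∑ a, (μ a).toReal = 1 := by
  have h : ∑ a, μ a = 1 := (tsum_fintype _).symm.trans μ.tsum_coe
  rw [← ENNReal.toReal_sum fun a _ => μ.apply_ne_top a, h, ENNReal.toReal_one]

open scoped Classical in
theorem prob_map_uniform {β : Type} (s : ℕ) (f : List Bool → β) (E : Set β) :
    prob ((PMF.uniformOfFintype (List.Vector Bool s)).map fun r => f r.toList) E
      = (1 / 2) ^ s * ∑ b : Fin s → Bool, if f (List.ofFn b) ∈ E then 1 else 0 := by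
  rw [← PMF.bind_pure_comp, prob_bind, Finset.mul_sum,
    ← (Equiv.vectorEquivFin Bool s).symm.sum_comp]
  refine Finset.sum_congr rfl fun b _ => ?_
  rw [PMF.uniformOfFintype_apply, comp_apply, prob_pure]
  have h : ((Equiv.vectorEquivFin Bool s).symm b).toList = List.ofFn b :=
    List.Vector.toList_ofFn b
  simp [h]

open scoped Classical in
/-- Disjoint pieces of a uniformly random string are independent and uniformly random. -/
theorem prob_map_uniform_take {β : Type} {l q s : ℕ} (hs : l + q ≤ s)
    (f : List Bool → β) (g : (Fin l → Bool) → List Bool → β)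
    (hf : ∀ (t : Fin l → Bool) r, List.ofFn t <+: r → f r = g t ((r.drop l).take q)) (E : Set β) :
    prob ((PMF.uniformOfFintype (List.Vector Bool s)).map fun r => f r.toList) E
      = (1 / 2) ^ l * ∑ t,
        prob ((PMF.uniformOfFintype (List.Vector Bool q)).map fun r => g t r.toList) E := by
  obtain ⟨c, rfl⟩ := Nat.exists_eq_add_of_le hs
  simp_rw [prob_map_uniform, ← Finset.mul_sum]
  have h : ∑ b : Fin (l + q + c) → Bool, (if f (List.ofFn b) ∈ E then 1 else 0 : ℝ)
      = ∑ t : Fin l → Bool, ∑ v : Fin q → Bool, ∑ _u : Fin c → Bool,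
        if g t (List.ofFn v) ∈ E then 1 else 0 := by
    rw [← (Fin.appendEquiv (l + q) c).sum_comp, Fintype.sum_prod_type,
      ← (Fin.appendEquiv l q).sum_comp, Fintype.sum_prod_type]
    refine Finset.sum_congr rfl fun t _ => Finset.sum_congr rfl fun v _ =>
      Finset.sum_congr rfl fun u _ => ?_
    have h1 : List.ofFn (Fin.appendEquiv (l + q) c (Fin.appendEquiv l q (t, v), u))
        = List.ofFn t ++ (List.ofFn v ++ List.ofFn u) := by
      rw [← List.append_assoc, ← List.ofFn_fin_append, ← List.ofFn_fin_append]
      rfl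
    rw [h1, hf t _ (List.prefix_append _ _), List.drop_left' (by simp), List.take_left' (by simp)]
  rw [h]
  simp only [Finset.sum_const, Finset.card_univ, Fintype.card_fun, Fintype.card_bool,
    Fintype.card_fin, nsmul_eq_mul, ← Finset.mul_sum, pow_add, Nat.cast_pow, Nat.cast_ofNat]
  have h2 : (1 / 2 : ℝ) ^ c * 2 ^ c = 1 := by rw [← mul_pow]; norm_num
  linear_combination ((1 / 2 : ℝ) ^ l * (1 / 2 : ℝ) ^ q *
    ∑ t : Fin l → Bool, ∑ v : Fin q → Bool, if g t (List.ofFn v) ∈ E then (1 : ℝ) else 0) * h2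

/-! ### Replacing random advice by a few samples of it -/

theorem two_rpow_le {f : ℝ} (h0 : 0 ≤ f) (h1 : f ≤ 1) : (2 : ℝ) ^ f ≤ 1 + f := by
  have h := rpow_one_add_le_one_add_mul_self (s := 1) (by norm_num) h0 h1
  norm_num at h
  exact h

/-- Samples of `μ`, one for each `t : T`, can be chosen such that, simultaneously for all strings
`x` of length `n`, the average of `fail x` over the samples exceeds twice the bound for its
expectation by at most `n / |T|`. The expectation of `∑ x, 2 ^ (∑ t, fail x (w t))` over independent
samples is at most `2 ^ n * (1 + ε) ^ |T|`, since `2 ^ f ≤ 1 + f` for `f` between `0` and `1`, and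
hence some choice of the samples respects this bound. -/
theorem exists_samples {W T : Type} [Fintype W] [Fintype T] (μ : PMF W) {n : ℕ}
    (fail : List.Vector Bool n → W → ℝ) (h0 : ∀ x w, 0 ≤ fail x w) (h1 : ∀ x w, fail x w ≤ 1)
    {ε : ℝ} (hε : ∀ x, ∑ w, (μ w).toReal * fail x w ≤ ε) :
    ∃ w : T → W, ∀ x, ∑ t, fail x (w t) ≤ n + 2 * ε * Fintype.card T := by
  classical
  -- The probability of the samples `w`, and the quantity whose expectation is bounded by `B`.
  let c (w : T → W) : ℝ := ∏ t, (μ (w t)).toReal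
  let Φ (w : T → W) : ℝ := ∑ x, ∏ t, (2 : ℝ) ^ fail x (w t)
  let B : ℝ := 2 ^ n * (1 + ε) ^ Fintype.card T
  have hc0 (w) : 0 ≤ c w := Finset.prod_nonneg fun _ _ => ENNReal.toReal_nonneg
  have hc : ∑ w, c w = 1 := by
    simp only [c]
    rw [← Fintype.piFinset_univ, ← Finset.prod_univ_sum (fun _ => Finset.univ)
      fun _ w => (μ w).toReal]
    simp [sum_toReal]
  have hμ : 0 ≤ ε := (Finset.sum_nonneg fun w _ =>
    mul_nonneg ENNReal.toReal_nonneg (h0 _ w)).trans (hε (List.Vector.replicate n false))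
  have hΦ : ∑ w, c w * Φ w ≤ B := by
    simp only [c, Φ, Finset.mul_sum, ← Finset.prod_mul_distrib]
    rw [Finset.sum_comm]
    have h (x) : ∑ w : T → W, ∏ t, (μ (w t)).toReal * (2 : ℝ) ^ fail x (w t)
        ≤ (1 + ε) ^ Fintype.card T := by
      rw [← Fintype.piFinset_univ, ← Finset.prod_univ_sum (fun _ => Finset.univ)
        fun _ w => (μ w).toReal * (2 : ℝ) ^ fail x w, Finset.prod_const, Finset.card_univ]
      refine pow_le_pow_left₀ (Finset.sum_nonneg fun w _ =>
        mul_nonneg ENNReal.toReal_nonneg (Real.rpow_nonneg zero_le_two _)) ?_ _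
      calc ∑ w, (μ w).toReal * (2 : ℝ) ^ fail x w
          ≤ ∑ w, (μ w).toReal * (1 + fail x w) := Finset.sum_le_sum fun w _ =>
            mul_le_mul_of_nonneg_left (two_rpow_le (h0 x w) (h1 x w)) ENNReal.toReal_nonneg
        _ = 1 + ∑ w, (μ w).toReal * fail x w := by
            simp only [mul_add, mul_one, Finset.sum_add_distrib, sum_toReal]
        _ ≤ 1 + ε := by gcongr; exact hε x
    refine (Finset.sum_le_sum fun x _ => h x).trans ?_
    simp [B, Finset.sum_const, Finset.card_univ]
  -- A weighted average of `Φ` is at most `B`, and so is some value of `Φ`.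
  obtain ⟨w, hw⟩ : ∃ w, Φ w ≤ B := by
    by_contra! hB
    have h2 : ∑ w, c w * (Φ w - B) = 0 := by
      refine le_antisymm ?_ (Finset.sum_nonneg fun w _ =>
        mul_nonneg (hc0 w) (sub_nonneg.2 (hB w).le))
      simp only [mul_sub, Finset.sum_sub_distrib, ← Finset.sum_mul, hc]
      linarith
    rw [Finset.sum_eq_zero_iff_of_nonneg fun w _ =>
      mul_nonneg (hc0 w) (sub_nonneg.2 (hB w).le)] at h2
    have h3 : ∑ w, c w = 0 := Finset.sum_eq_zero fun w hw =>
      (mul_eq_zero.1 (h2 w hw)).resolve_right (sub_pos.2 (hB w)).ne'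
    linarith
  refine ⟨w, fun x => ?_⟩
  have h2 : (2 : ℝ) ^ ∑ t, fail x (w t) ≤ 2 ^ (n + 2 * ε * Fintype.card T) := by
    calc (2 : ℝ) ^ ∑ t, fail x (w t) = ∏ t, (2 : ℝ) ^ fail x (w t) :=
          Real.rpow_sum_of_pos two_pos _ _
      _ ≤ Φ w := Finset.single_le_sum (f := fun x => ∏ t, (2 : ℝ) ^ fail x (w t))
          (fun x _ => Finset.prod_nonneg fun t _ => Real.rpow_nonneg zero_le_two _)
          (Finset.mem_univ x)
      _ ≤ B := hw
      _ ≤ 2 ^ n * ((2 : ℝ) ^ (2 * ε)) ^ Fintype.card T := by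
          refine mul_le_mul_of_nonneg_left (pow_le_pow_left₀ (by positivity) ?_ _) (by positivity)
          -- The inequality of Bernoulli, for `1 + ε ≤ 4 ^ ε`.
          have h3 := one_add_mul_self_le_rpow_one_add (s := 1) (by norm_num)
            (p := 1 + 2 * ε) (by linarith)
          rw [Real.rpow_add (by norm_num)] at h3
          norm_num at h3
          linarith
      _ = 2 ^ (n + 2 * ε * Fintype.card T) := by
          rw [Real.rpow_add two_pos, Real.rpow_natCast, Real.rpow_mul_natCast zero_le_two]
  exact (Real.rpow_le_rpow_left_iff one_lt_two).1 h2

/-- The length of the tags that number the samples. -/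
def tagLength (n m : ℕ) : ℕ := Nat.log 2 (2 * m * n + 1) + 1

theorem tagLength_pos (n m : ℕ) : 0 < tagLength n m := Nat.succ_pos _

theorem lt_two_pow_tagLength (n m : ℕ) : 2 * m * n < 2 ^ tagLength n m :=
  (Nat.lt_succ_self _).trans (Nat.lt_pow_succ_log_self one_lt_two _)

theorem two_pow_tagLength_le (n m : ℕ) : 2 ^ tagLength n m ≤ 2 * (2 * m * n + 1) := by
  rw [tagLength, pow_succ, mul_comm]
  exact Nat.mul_le_mul_left 2 (Nat.pow_log_le_self 2 (Nat.succ_ne_zero _))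

/-- The algorithms of a kind can be averaged over polynomially many advice strings: for the
instance `(x, 0^m)`, one of `2 ^ tagLength n m` advice strings `w t` is chosen uniformly, and the
given algorithm is run with this advice and with error parameter `4 * m`. -/
def Averageable (alg : Behaviour → Prop) : Prop :=
  ∀ S, alg S → ∀ p : MvPolynomial (Fin 2) ℕ, ∃ S' p', alg S' ∧
    ∀ (n m : ℕ) (w : (Fin (tagLength n m) → Bool) → List.Vector Bool (evalPoly p n (4 * m))),
      ∃ a : List.Vector Bool (evalPoly p' n m), ∀ x : List Bool, x.length = n → ∀ E,
        prob (S' ⟨x, m, a.toList⟩) E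
          = (1 / 2) ^ tagLength n m * ∑ t, prob (S ⟨x, 4 * m, (w t).toList⟩) E

theorem withRPoly_subset_withPoly {alg : Behaviour → Prop} (h : Averageable alg) :
    withRPoly alg ⊆ withPoly alg := by
  classical
  rintro R ⟨hR, S, p, D, hS, hD⟩
  obtain ⟨S', p', hS', hav⟩ := h S hS p
  have key (n m : ℕ) : ∃ a : List.Vector Bool (evalPoly p' n m), 1 ≤ m →
      ∀ x : List Bool, x.length = n → (∃ y, (x, y) ∈ R) →
        1 - 1 / (m : ℝ) ≤ prob (S' ⟨x, m, a.toList⟩) {y | (x, y) ∈ R} := by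
    rcases Nat.eq_zero_or_pos m with rfl | hm
    · exact ⟨List.Vector.replicate _ false, fun h => absurd h (by norm_num)⟩
    let fail (x : List.Vector Bool n) (w : List.Vector Bool (evalPoly p n (4 * m))) : ℝ :=
      if ∃ y, (x.toList, y) ∈ R then
        1 - prob (S ⟨x.toList, 4 * m, w.toList⟩) {y | (x.toList, y) ∈ R} else 0
    obtain ⟨w, hw⟩ := exists_samples (T := Fin (tagLength n m) → Bool) (D n (4 * m)) fail
      (fun x w => by
        simp only [fail]; split_ifs
        · linarith [prob_le_one (S ⟨x.toList, 4 * m, w.toList⟩) {y | (x.toList, y) ∈ R}]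
        · rfl)
      (fun x w => by
        simp only [fail]; split_ifs
        · linarith [prob_nonneg (S ⟨x.toList, 4 * m, w.toList⟩) {y | (x.toList, y) ∈ R}]
        · exact zero_le_one)
      (ε := 1 / (4 * m : ℕ)) (fun x => by
        by_cases hx : ∃ y, (x.toList, y) ∈ R
        · have := hD x.toList hx (4 * m) (by omega)
          rw [prob_bind, x.toList_length] at this
          simp only [fail, if_pos hx, mul_sub, mul_one, Finset.sum_sub_distrib, sum_toReal]
          linarith
        · simp only [fail, if_neg hx, mul_zero, Finset.sum_const_zero]
          positivity)
    obtain ⟨a, ha⟩ := hav n m w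
    refine ⟨a, fun _ x hx hxR => ?_⟩
    rw [ha x hx]
    have h2 := hw ⟨x, hx⟩
    have hf (u : List.Vector Bool (evalPoly p n (4 * m))) : fail ⟨x, hx⟩ u
        = 1 - prob (S ⟨x, 4 * m, u.toList⟩) {y | (x, y) ∈ R} := if_pos hxR
    simp only [hf, Finset.sum_sub_distrib, Finset.sum_const,
      Finset.card_univ, Fintype.card_fun, Fintype.card_bool, Fintype.card_fin, nsmul_eq_mul,
      mul_one] at h2
    have h3 : (2 * m * n : ℝ) ≤ 2 ^ tagLength n m := mod_cast (lt_two_pow_tagLength n m).le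
    have hm' : (0 : ℝ) < m := mod_cast hm
    push_cast at h2
    generalize ∑ t, prob (S ⟨x, 4 * m, (w t).toList⟩) {y | (x, y) ∈ R} = s at h2 ⊢
    have hk : (0 : ℝ) < 2 ^ tagLength n m := by positivity
    rw [one_div_pow]
    generalize (2 : ℝ) ^ tagLength n m = k at h2 h3 hk ⊢
    -- Both contributions to the total failure are at most `k / (2 * m)`.
    have h4 : (n : ℝ) ≤ k / (2 * m) := by rw [le_div_iff₀ (by positivity)]; linarith
    have h5 : 2 * (1 / (4 * m : ℝ)) * k = k / (2 * m) := by field_simp; norm_num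
    have h6 : k * (1 - 1 / m) ≤ s := by
      have : k * (1 - 1 / m) = k - (k / (2 * m) + k / (2 * m)) := by field_simp; ring
      linarith
    rwa [one_div_mul_eq_div, le_div_iff₀ hk, mul_comm]
  choose a ha using key
  exact ⟨hR, S', p', a, hS', fun x hx m hm => ha _ m hm x rfl hx⟩

theorem withPoly_subset_withRPoly (alg : Behaviour → Prop) : withPoly alg ⊆ withRPoly alg := by
  rintro R ⟨hR, S, p, a, hS, ha⟩
  refine ⟨hR, S, p, fun n m => PMF.pure (a n m), hS, fun x hx m hm => ?_⟩
  rw [PMF.pure_bind]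
  exact ha x hx m hm

/-! ### Polynomials in two variables -/

/-- Functions given by a polynomial in two variables. -/
def IsPoly (f : ℕ → ℕ → ℕ) : Prop :=
  ∃ p : MvPolynomial (Fin 2) ℕ, ∀ n m, evalPoly p n m = f n m

namespace IsPoly

variable {f g : ℕ → ℕ → ℕ}

theorem of (p : MvPolynomial (Fin 2) ℕ) : IsPoly (evalPoly p) := ⟨p, fun _ _ => rfl⟩

theorem fst : IsPoly fun n _ => n := ⟨.X 0, fun n m => by simp [evalPoly]⟩

theorem snd : IsPoly fun _ m => m := ⟨.X 1, fun n m => by simp [evalPoly]⟩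

theorem const (c : ℕ) : IsPoly fun _ _ => c := ⟨.C c, fun n m => by simp [evalPoly]⟩

theorem add (hf : IsPoly f) (hg : IsPoly g) : IsPoly fun n m => f n m + g n m := by
  obtain ⟨p, hp⟩ := hf
  obtain ⟨q, hq⟩ := hg
  exact ⟨p + q, fun n m => (map_add _ p q).trans (congrArg₂ _ (hp n m) (hq n m))⟩

theorem mul (hf : IsPoly f) (hg : IsPoly g) : IsPoly fun n m => f n m * g n m := by
  obtain ⟨p, hp⟩ := hf
  obtain ⟨q, hq⟩ := hg
  exact ⟨p * q, fun n m => (map_mul _ p q).trans (congrArg₂ _ (hp n m) (hq n m))⟩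

theorem eval (hf : IsPoly f) (q : Polynomial ℕ) : IsPoly fun n m => q.eval (f n m) := by
  induction q using Polynomial.induction_on' with
  | add p q hp hq => simpa using hp.add hq
  | monomial k c =>
    have h : IsPoly fun n m => f n m ^ k := by
      induction k with
      | zero => simpa using const 1
      | succ k ih => simpa [pow_succ] using ih.mul hf
    simpa using (const c).mul h

theorem evalPoly_mul_right (p : MvPolynomial (Fin 2) ℕ) (c : ℕ) :
    IsPoly fun n m => evalPoly p n (c * m) := by
  refine ⟨p.bind₁ ![.X 0, .C c * .X 1], fun n m => ?_⟩
  refine (MvPolynomial.eval₂Hom_bind₁ _ _ _ _).trans (congrArg (MvPolynomial.eval · p) ?_)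
  funext i
  fin_cases i <;> simp

end IsPoly

/-! ### Advice strings -/

/-- A string filled up with zeros to length `k`. -/
def padTo (k : ℕ) (u : List Bool) : List.Vector Bool k :=
  ⟨(u ++ List.replicate (k - u.length) false).take k, by simp; omega⟩

theorem decode_padTo {k : ℕ} {L : List (List Bool)} (hL : L ≠ [])
    (hk : 2 * (encodeStrings L).length ≤ k) : decode (padTo k (code L)).toList = L := by
  have h := (length_code_le L).trans hk
  rw [padTo, List.Vector.toList_mk, List.take_of_length_le (by simp; omega), decode_code hL]

/-- A block of advice: the tag `t`, the error parameter `M`, the advice `w` for the given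
algorithm, and the number `o` of measured or random bits to be skipped. -/
def block {l : ℕ} (M : ℕ) (w : List Bool) (o : ℕ) (t : Fin l → Bool) : List Bool :=
  code [List.ofFn t, List.replicate M false, w, List.replicate o true]

theorem decode_block {l : ℕ} (M : ℕ) (w : List Bool) (o : ℕ) (t : Fin l → Bool) :
    decode (block M w o t)
      = [List.ofFn t, List.replicate M false, w, List.replicate o true] := by
  have h := decode_code (List.cons_ne_nil (List.ofFn t)
    [List.replicate M false, w, List.replicate o true]) 0
  rwa [List.replicate_zero, List.append_nil] at h

/-- A header `h` followed by one block for each tag. -/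
def adviceStrings {l : ℕ} (h : List Bool) (M : ℕ) (w : (Fin l → Bool) → List Bool)
    (o : (Fin l → Bool) → ℕ) : List (List Bool) :=
  h :: Finset.univ.toList.map fun t => block M (w t) (o t) t

/-- The length of the advice, for a header of length at most `H`, at most `K` tags, and blocks
with parameters at most `M`, `P` and `O`. The first summand makes room for the code, and the other
two make sure that there are enough random bits or qubits, as their number is at least the length
of the advice. -/
def adviceLength (H K M P O : ℕ) : ℕ :=
  2 * (H + 1 + K * (2 * (K + M + P + O + 4) + 1)) + H + O

theorem length_adviceStrings_le {l : ℕ} {h : List Bool} {M : ℕ} {w : (Fin l → Bool) → List Bool}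
    {o : (Fin l → Bool) → ℕ} {H K P O : ℕ} (hH : h.length ≤ H) (hK : 2 ^ l ≤ K)
    (hP : ∀ t, (w t).length ≤ P) (hO : ∀ t, o t ≤ O) :
    2 * (encodeStrings (adviceStrings h M w o)).length ≤ adviceLength H K M P O := by
  have h1 (t) : (block M (w t) (o t) t).length + 1 ≤ 2 * (K + M + P + O + 4) + 1 := by
    have h2 := length_code_le
      [List.ofFn t, List.replicate M false, w t, List.replicate (o t) true]
    simp only [length_encodeStrings, List.map_cons, List.map_nil, List.sum_cons, List.sum_nil,
      List.length_ofFn, List.length_replicate] at h2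
    have := hP t
    have := hO t
    have := Nat.lt_two_pow_self (n := l)
    rw [block]
    omega
  have h2 : ((Finset.univ.toList.map fun t => block M (w t) (o t) t).map fun u =>
      u.length + 1).sum ≤ K * (2 * (K + M + P + O + 4) + 1) := by
    rw [List.map_map]
    refine (List.sum_le_card_nsmul _ (2 * (K + M + P + O + 4) + 1) fun y hy => ?_).trans ?_
    · obtain ⟨t, _, rfl⟩ := List.mem_map.1 hy
      exact h1 t
    · simp only [List.length_map, Finset.length_toList, Finset.card_univ, Fintype.card_fun,
        Fintype.card_bool, Fintype.card_fin, smul_eq_mul]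
      exact Nat.mul_le_mul_right _ hK
  rw [length_encodeStrings, adviceStrings, List.map_cons, List.sum_cons, adviceLength]
  omega

theorem flatMap_ite_eq {σ τ : Type} [DecidableEq σ] {s : List σ} (hs : s.Nodup) {t : σ}
    (ht : t ∈ s) (L : List τ) : (s.flatMap fun i => if i = t then L else []) = L := by
  have h0 (s : List σ) (ht : t ∉ s) : (s.flatMap fun i => if i = t then L else []) = [] := by
    refine List.flatMap_eq_nil_iff.2 fun i hi => if_neg ?_
    rintro rfl
    exact ht hi
  induction s with
  | nil => simp at ht
  | cons i s ih =>
    rw [List.nodup_cons] at hs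
    rw [List.flatMap_cons]
    by_cases hi : i = t
    · subst hi
      rw [if_pos rfl, h0 s hs.1, List.append_nil]
    · rw [if_neg hi, List.nil_append]
      exact ih hs.2 ((List.mem_cons.1 ht).resolve_left (Ne.symm hi))

section Selection

variable {l : ℕ} {h : List Bool} {M : ℕ} {w : (Fin l → Bool) → List Bool}
  {o : (Fin l → Bool) → ℕ} {z : Instance} (hz : decode z.a = adviceStrings h M w o)
  {t : Fin l → Bool} {r : List Bool} (ht : List.ofFn t <+: r)
include hz ht

theorem selection_eq :
    selection (z, r) = [List.replicate M false, w t, List.replicate (o t) true] := by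
  have h1 (s : Fin l → Bool) : List.ofFn s <+: r ↔ s = t := by
    refine ⟨fun hs => List.ofFn_injective ?_, fun hs => hs ▸ ht⟩
    exact (List.prefix_of_prefix_length_le hs ht (by simp)).eq_of_length (by simp)
  simp only [selection, selected, hz, adviceStrings, List.tail_cons, List.flatMap_map,
    decode_block, matchTag, h1]
  rw [← flatMap_ite_eq (Finset.nodup_toList _) (Finset.mem_toList.2 (Finset.mem_univ t))
    [List.replicate M false, w t, List.replicate (o t) true]]
  refine List.flatMap_congr fun s _ => ?_
  split_ifs with hs
  · rw [hs]
  · rfl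

theorem selectedInstance_eq : selectedInstance (z, r) = ⟨z.x, M, w t⟩ := by
  simp [selectedInstance, selection_eq hz ht]

theorem selectedBits_eq : selectedBits (z, r) = r.drop (o t) := by
  simp [selectedBits, selection_eq hz ht]

end Selection

/-! ### Randomized algorithms -/

theorem Deterministic.randomized {S : Behaviour} (hS : Deterministic S) : Randomized S := by
  obtain ⟨A, hA, hS⟩ := hS
  refine ⟨fun zr => A zr.1, 0, ?_, fun z => ?_⟩
  · exact PolyTime.comp (f := Prod.fst)
      (polyTime_withBits_x.instance (polyTime_getD withBits 1) polyTime_withBits_a |>.congr_output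
        fun zr => by simp [Instance.strings, withBits]) hA
  · rw [hS]
    exact (PMF.map_const _ _).symm

theorem Randomized.exists_map {S : Behaviour} (hS : Randomized S) :
    ∃ (A : Instance × List Bool → List Bool) (q : Polynomial ℕ), PolyTime withBits single A ∧
      ∀ z k, q.eval z.size = k → S z = (PMF.uniformOfFintype (List.Vector Bool k)).map
        fun r => A (z, r.toList) := by
  obtain ⟨A, q, hA, hS⟩ := hS
  refine ⟨A, q, hA, fun z k hk => ?_⟩
  subst hk
  exact hS z

theorem Randomized.of_map {A : Instance × List Bool → List Bool} {s : Instance → ℕ}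
    (q : Polynomial ℕ) (hA : PolyTime withBits single A) (hs : ∀ z, q.eval z.size = s z) :
    Randomized fun z => (PMF.uniformOfFintype (List.Vector Bool (s z))).map
      fun r => A (z, r.toList) := by
  obtain rfl : (fun z => q.eval z.size) = s := funext hs
  exact ⟨A, q, hA, fun _ => rfl⟩

theorem FP_rpoly_subset_FBPP_rpoly : FP_rpoly ⊆ FBPP_rpoly := by
  rintro R ⟨hR, S, p, D, hS, hD⟩
  exact ⟨hR, S, p, D, hS.randomized, hD⟩

/-- Random bits can be supplied by randomized advice. -/
theorem FBPP_rpoly_subset_FP_rpoly : FBPP_rpoly ⊆ FP_rpoly := by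
  rintro R ⟨hR, S, p, D, hS, hD⟩
  obtain ⟨A, q, hA, hS⟩ := hS.exists_map
  let s (n m : ℕ) : ℕ := q.eval (n + m + evalPoly p n m)
  have hp : IsPoly fun n m => 2 * (evalPoly p n m + s n m + 2) :=
    (IsPoly.const 2).mul (((IsPoly.of p).add
      (((IsPoly.fst.add .snd).add (.of p)).eval q)).add (IsPoly.const 2))
  obtain ⟨p', hp'⟩ := hp
  let A' (z : Instance) : List Bool :=
    A (⟨z.x, z.m, (decode z.a).getD 0 []⟩, (decode z.a).getD 1 [])
  have ha : PolyTime Instance.strings id fun z => decode z.a :=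
    (polyTime_getD Instance.strings 2).decode
  have hz : PolyTime Instance.strings Instance.strings
      fun z => ⟨z.x, z.m, (decode z.a).getD 0 []⟩ := by
    refine ((polyTime_getD Instance.strings 0).instance (polyTime_getD Instance.strings 1)
      (ha.getD 0)).congr_output fun z => ?_
    simp [Instance.strings]
  refine ⟨hR, fun z => PMF.pure (A' z), p', fun n m => (D n m).bind fun w =>
    (PMF.uniformOfFintype (List.Vector Bool (s n m))).map fun r =>
      padTo _ (code [w.toList, r.toList]), ⟨A', (hz.withBits (ha.getD 1)).comp hA, fun _ => rfl⟩,
    fun x hx m hm => ?_⟩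
  refine (hD x hx m hm).trans_eq ?_
  rw [PMF.bind_bind]
  congr 2
  funext w
  rw [hS _ (s x.length m) (by simp [Instance.size, s]), PMF.bind_map, ← PMF.bind_pure_comp]
  congr 1
  funext r
  have hd := decode_padTo (k := evalPoly p' x.length m) (L := [w.toList, r.toList])
    (List.cons_ne_nil _ _) (by simp [hp', length_encodeStrings]; omega)
  simp [A', hd]

theorem isPoly_two_pow_tagLength_bound : IsPoly fun n m => 2 * (2 * m * n + 1) :=
  (IsPoly.const 2).mul ((((IsPoly.const 2).mul IsPoly.snd).mul IsPoly.fst).add (IsPoly.const 1))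

theorem IsPoly.adviceLength {H K M P O : ℕ → ℕ → ℕ} (hH : IsPoly H) (hK : IsPoly K) (hM : IsPoly M)
    (hP : IsPoly P) (hO : IsPoly O) :
    IsPoly fun n m => RelAdvice.adviceLength (H n m) (K n m) (M n m) (P n m) (O n m) :=
  (((IsPoly.const 2).mul ((hH.add (.const 1)).add (hK.mul
    (((IsPoly.const 2).mul ((((hK.add hM).add hP).add hO).add (.const 4))).add
      (.const 1))))).add hH).add hO

theorem averageable_randomized : Averageable Randomized := by
  intro S hS p
  obtain ⟨A, q, hA, hS⟩ := hS.exists_map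
  have hP := IsPoly.evalPoly_mul_right p 4
  have hM : IsPoly fun _ m => 4 * m := (IsPoly.const 4).mul .snd
  obtain ⟨p', hp'⟩ := IsPoly.adviceLength (((IsPoly.fst.add hM).add hP).eval q)
    isPoly_two_pow_tagLength_bound hM hP isPoly_two_pow_tagLength_bound
  let A' (zr : Instance × List Bool) : List Bool :=
    A (selectedInstance zr, (selectedBits zr).take ((decode zr.1.a).headD []).length)
  let S' : Behaviour := fun z =>
    (PMF.uniformOfFintype (List.Vector Bool z.size)).map fun r => A' (z, r.toList)
  have hS' : Randomized S' := by
    refine .of_map .X ((polyTime_selectedInstance.withBits ?_).comp hA) fun z => Polynomial.eval_X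
    exact (polyTime_withBits_a.decode.comp polyTime_head).take polyTime_selectedBits
  refine ⟨S', p', hS', fun n m w => ?_⟩
  -- The header prescribes the number of random bits, which come after the tag.
  obtain ⟨k, hk⟩ : ∃ k, q.eval (n + 4 * m + evalPoly p n (4 * m)) = k := ⟨_, rfl⟩
  let L := adviceStrings (List.replicate k true) (4 * m) (fun t => (w t).toList)
    fun _ => tagLength n m
  have hl : tagLength n m ≤ 2 * (2 * m * n + 1) :=
    Nat.lt_two_pow_self.le.trans (two_pow_tagLength_le n m)
  have hd : decode (padTo (evalPoly p' n m) (code L)).toList = L := by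
    refine decode_padTo (List.cons_ne_nil _ _) ?_
    rw [hp']
    exact length_adviceStrings_le (by simp [hk]) (two_pow_tagLength_le n m) (by simp) fun _ => hl
  refine ⟨padTo _ (code L), fun x hx E => ?_⟩
  have hs (t) : S ⟨x, 4 * m, (w t).toList⟩ = (PMF.uniformOfFintype (List.Vector Bool k)).map
      fun r => A (⟨x, 4 * m, (w t).toList⟩, r.toList) :=
    hS _ _ (by rw [← hk]; simp [Instance.size, hx])
  simp_rw [hs]
  refine prob_map_uniform_take ?_ (fun r => A' (⟨x, m, _⟩, r))
    (fun t r => A (⟨x, 4 * m, (w t).toList⟩, r)) (fun t r htr => ?_) E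
  · simp only [Instance.size, List.Vector.toList_length, hp', adviceLength]
    omega
  · simp only [A']
    rw [selectedInstance_eq hd htr, selectedBits_eq hd htr, hd]
    simp [L, adviceStrings]

/-! ### Quantum algorithms -/

theorem toGate_shift {M N k : ℕ} (e : Fin M ↪ Fin N) (he : ∀ i, (e i : ℕ) = i + k) (g : Gate M) :
    (g.shift k).toGate N = some (g.map e) := by
  have h (i : Fin M) (hi : (i : ℕ) + k < N) : (⟨i + k, hi⟩ : Fin N) = e i := Fin.ext (he i).symm
  have hN (i : Fin M) : (i : ℕ) + k < N := (he i).symm.trans_lt (e i).isLt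
  cases g <;> simp [Gate.shift, RawGate.toGate, Gate.map, h, hN]

/-- The header of quantum advice: strings whose lengths are the first `l` qubits. -/
def qubitStrings (l : ℕ) : List (List Bool) :=
  (List.finRange l).map fun i : Fin l => List.replicate i false

theorem length_code_qubitStrings_le (l : ℕ) : (code (qubitStrings l)).length ≤ 2 * (l * l) := by
  refine (length_code_le _).trans (Nat.mul_le_mul_left 2 ?_)
  rw [length_encodeStrings, qubitStrings, List.map_map]
  refine (List.sum_le_card_nsmul _ l fun y hy => ?_).trans (by simp)
  obtain ⟨i, _, rfl⟩ := List.mem_map.1 hy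
  simp only [comp_apply, List.length_replicate]
  exact i.isLt

theorem decode_code_qubitStrings {l : ℕ} (hl : 0 < l) :
    decode (code (qubitStrings l)) = qubitStrings l := by
  have h : qubitStrings l ≠ [] := by
    refine List.ne_nil_of_length_pos ?_
    simpa [qubitStrings] using hl
  simpa using decode_code h 0

/-- The position of a block in the circuit, with `B` qubits for each block after the tag. -/
def tagOffset {l : ℕ} (B : ℕ) (t : Fin l → Bool) : ℕ := l + B * Fintype.equivFin (Fin l → Bool) t

theorem tagOffset_add_le {l B : ℕ} (t : Fin l → Bool) : tagOffset B t + B ≤ l + 2 ^ l * B := by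
  have h : (Fintype.equivFin (Fin l → Bool) t : ℕ) + 1 ≤ 2 ^ l :=
    (Fintype.equivFin (Fin l → Bool) t).isLt.trans_eq (by simp)
  have := Nat.mul_le_mul_right B h
  rw [tagOffset]
  linarith

theorem tagOffset_inj {l B : ℕ} {s t : Fin l → Bool} {a b : ℕ} (ha : a < B) (hb : b < B)
    (h : a + tagOffset B s = b + tagOffset B t) : s = t := by
  have h1 (c x : ℕ) (hc : c < B) : (c + B * x) / B = x := by
    rw [Nat.add_mul_div_left _ _ (by omega), Nat.div_eq_of_lt hc, Nat.zero_add]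
  refine (Fintype.equivFin (Fin l → Bool)).injective (Fin.ext ?_)
  refine (h1 a _ ha).symm.trans ((congrArg (· / B) ?_).trans (h1 b _ hb))
  simp only [tagOffset] at h
  omega

/-- Run the given algorithm with the advice and the measured bits selected by the tag. -/
def selectedOutput (Q : Instance → Circuit) (A : Instance × List Bool → List Bool)
    (zb : Instance × List Bool) : List Bool :=
  A (selectedInstance zb, (selectedBits zb).take (Q (selectedInstance zb)).N)

theorem polyTime_selectedOutput {Q : Instance → Circuit} {A : Instance × List Bool → List Bool}
    (hQ : PolyTime Instance.strings Circuit.strings Q) (hA : PolyTime withBits single A) :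
    PolyTime withBits single (selectedOutput Q A) := by
  have h : PolyTime withBits single fun zb => unary (Q (selectedInstance zb)).N :=
    (polyTime_selectedInstance.comp hQ).comp (polyTime_getD Circuit.strings 0)
  refine PolyTime.comp (g := A) (polyTime_selectedInstance.withBits ?_) hA
  simpa [unary] using h.take polyTime_selectedBits

section Parallel

variable (Q : Instance → Circuit) {z : Instance} {l B M : ℕ} {w : (Fin l → Bool) → List Bool}

/-- The first qubit of each block. -/
def offset (l B : ℕ) : Option (Fin l → Bool) → ℕ
  | none => 0
  | some t => tagOffset B t

/-- The block of the tag, followed by the blocks for all tags. -/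
def allBlocks (l : ℕ) : List (Option (Fin l → Bool)) := none :: Finset.univ.toList.map some

theorem parallelGates_eq (hl : 0 < l)
    (hz : decode z.a = adviceStrings (code (qubitStrings l)) M w (tagOffset B)) :
    parallelGates Q z = (allBlocks l).flatMap fun i =>
      (blockCircuit (fun t => Q ⟨z.x, M, w t⟩) i).gates.map (Gate.shift (offset l B i)) := by
  rw [parallelGates, hz, adviceStrings, List.headD_cons, List.tail_cons,
    decode_code_qubitStrings hl, allBlocks, List.flatMap_cons, List.flatMap_map, List.flatMap_map]
  congr 1
  · simp only [qubitStrings, blockCircuit, uniformCircuit, List.map_map]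
    exact List.map_congr_left fun i _ => by simp [Gate.shift, offset]
  · refine List.flatMap_congr fun t _ => ?_
    have h1 : blockInstance z.x (block M (w t) (tagOffset B t) t) = ⟨z.x, M, w t⟩ := by
      simp [blockInstance, decode_block]
    have h2 : blockOffset (block M (w t) (tagOffset B t) t) = offset l B (some t) := by
      simp [blockOffset, decode_block, offset]
    rw [blockGates, h1, h2, blockCircuit]

theorem length_lt_parallelCircuit : z.a.length < (parallelCircuit Q z).N := by
  simp only [parallelCircuit, bits, List.map_append, List.map_cons, List.map_nil, List.sum_append,
    List.sum_cons, List.sum_nil]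
  omega

/-- The parallel circuit followed by the selection of the output according to the measured tag
averages the given algorithm over the advice strings in the blocks. -/
theorem prob_parallelCircuit (A : Instance × List Bool → List Bool) (hl : 0 < l)
    (hz : decode z.a = adviceStrings (code (qubitStrings l)) M w (tagOffset B))
    (hB : ∀ t, (Q ⟨z.x, M, w t⟩).N ≤ B) (ha : l + 2 ^ l * B ≤ z.a.length) (E : Set (List Bool)) :
    prob ((parallelCircuit Q z).outcome.map fun b => selectedOutput Q A (z, List.ofFn b)) E
      = (1 / 2) ^ l * ∑ t, prob ((Q ⟨z.x, M, w t⟩).outcome.map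
        fun b => A (⟨z.x, M, w t⟩, List.ofFn b)) E := by
  let C (t : Fin l → Bool) : Circuit := Q ⟨z.x, M, w t⟩
  have hN (i) (a : Fin (blockCircuit C i).N) : a + offset l B i < (parallelCircuit Q z).N := by
    refine lt_trans ?_ (length_lt_parallelCircuit Q)
    refine lt_of_lt_of_le ?_ ha
    cases i with
    | none => exact Nat.lt_add_right _ a.isLt
    | some t =>
      have h1 : (a : ℕ) < B := a.isLt.trans_le (hB t)
      have h2 := tagOffset_add_le (B := B) t
      simp only [offset]
      omega
  -- Qubit `a` of block `i` becomes qubit `a + offset l B i`; the blocks are disjoint, as no circuit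
  -- has more than `B` qubits.
  let e : (Σ i, Fin (blockCircuit C i).N) ↪ Fin (parallelCircuit Q z).N :=
    { toFun := fun x => ⟨x.2 + offset l B x.1, hN x.1 x.2⟩
      inj' := by
        rintro ⟨i, a⟩ ⟨j, b⟩ h
        have h : (a : ℕ) + offset l B i = b + offset l B j := congrArg Fin.val h
        obtain rfl : i = j := by
          cases i with
          | none =>
            cases j with
            | none => rfl
            | some t =>
              have : (a : ℕ) < l := a.isLt
              simp only [offset, tagOffset] at h
              omega
          | some s =>
            cases j with
            | none =>
              have : (b : ℕ) < l := b.isLt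
              simp only [offset, tagOffset] at h
              omega
            | some t =>
              exact congrArg some
                (tagOffset_inj (a.isLt.trans_le (hB s)) (b.isLt.trans_le (hB t)) h)
        rw [Fin.ext (Nat.add_right_cancel h)] }
  refine prob_parallel C (parallelCircuit Q z) e (allBlocks l) ?_ (fun i => ?_) ?_ _
    (fun t b => A (⟨z.x, M, w t⟩, List.ofFn b)) (fun t b ht => ?_) E
  · rw [allBlocks, List.nodup_cons]
    exact ⟨by simp, (Finset.nodup_toList _).map (Option.some_injective _)⟩
  · cases i <;> simp [allBlocks]
  · have h : (parallelCircuit Q z).gates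
        = (parallelGates Q z).filterMap (RawGate.toGate (parallelCircuit Q z).N) := rfl
    rw [h, parallelGates_eq Q hl hz, List.filterMap_flatMap]
    refine List.flatMap_congr fun i _ => ?_
    rw [List.filterMap_map, ← List.filterMap_eq_map]
    refine List.filterMap_congr fun g _ => ?_
    exact toGate_shift (blockEmb e i) (fun _ => rfl) g
  -- The tag is measured in the first `l` qubits, and the block of this tag is read off.
  · have htag : List.ofFn t <+: List.ofFn b := by
      rw [List.prefix_iff_eq_take, List.length_ofFn]
      have hl : l ≤ (parallelCircuit Q z).N := by
        have := length_lt_parallelCircuit Q (z := z)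
        omega
      refine List.ext_getElem (by simpa using hl) fun i h1 h2 => ?_
      have hi : i < l := by simpa using h1
      rw [List.getElem_take, List.getElem_ofFn, List.getElem_ofFn]
      exact (congrFun ht (⟨i, hi⟩ : Fin l)).symm
    rw [selectedOutput, selectedInstance_eq hz htag, selectedBits_eq hz htag]
    congr 2
    refine List.ext_getElem ?_ fun i h1 h2 => ?_
    · have h1 := tagOffset_add_le (B := B) t
      have h2 := length_lt_parallelCircuit Q (z := z)
      have h3 := hB t
      simp only [List.length_take, List.length_drop, List.length_ofFn]
      have h4 : (blockCircuit C (some t)).N = (Q ⟨z.x, M, w t⟩).N := rfl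
      have h5 : (C t).N = (Q ⟨z.x, M, w t⟩).N := rfl
      omega
    · rw [List.getElem_take, List.getElem_drop, List.getElem_ofFn, List.getElem_ofFn]
      exact congrArg b (Fin.ext (Nat.add_comm _ _))

end Parallel

/-- A circuit written down in polynomial time has polynomially many qubits. -/
theorem PolyTime.exists_qubits_le {Q : Instance → Circuit}
    (hQ : PolyTime Instance.strings Circuit.strings Q) :
    ∃ q : Polynomial ℕ, ∀ z, (Q z).N ≤ q.eval (z.size + 3) := by
  obtain ⟨_, _, q, hq⟩ := hQ.exists_answers
  refine ⟨q, fun z => ?_⟩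
  have h := (hq z).2
  have h1 : (encodeStrings z.strings).length = z.size + 3 := by
    simp [length_encodeStrings, Instance.strings, Instance.size]
    omega
  have h2 := length_lt_of_mem (L := (Q z).strings) (u := unary (Q z).N) (by simp [Circuit.strings])
  rw [h1] at h
  simp only [unary, List.length_replicate] at h2
  omega

theorem averageable_quantum : Averageable Quantum := by
  rintro S ⟨Q, A, hQ, hA, hS⟩ p
  obtain ⟨q, hq⟩ := hQ.exists_qubits_le
  have hP := IsPoly.evalPoly_mul_right p 4
  have hM : IsPoly fun _ m => 4 * m := (IsPoly.const 4).mul .snd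
  have hK := isPoly_two_pow_tagLength_bound
  have hB := (((IsPoly.fst.add hM).add hP).add (.const 3)).eval q
  obtain ⟨p', hp'⟩ := IsPoly.adviceLength ((IsPoly.const 2).mul (hK.mul hK)) hK hM hP
    (hK.add (hK.mul hB))
  refine ⟨_, p', ⟨parallelCircuit Q, selectedOutput Q A, polyTime_parallelCircuit hQ,
    polyTime_selectedOutput hQ hA, fun z => rfl⟩, fun n m w => ?_⟩
  -- All circuits to be run for inputs of length `n` have at most `B` qubits.
  obtain ⟨B, hB⟩ : ∃ B, q.eval (n + 4 * m + evalPoly p n (4 * m) + 3) = B := ⟨_, rfl⟩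
  have hp' := hp' n m
  simp only [hB] at hp'
  have hk := two_pow_tagLength_le n m
  generalize 2 * (2 * m * n + 1) = K at hk hp'
  have hl : tagLength n m ≤ K := Nat.lt_two_pow_self.le.trans hk
  have hlB : tagLength n m + 2 ^ tagLength n m * B ≤ K + K * B :=
    Nat.add_le_add hl (Nat.mul_le_mul_right B hk)
  let L := adviceStrings (code (qubitStrings (tagLength n m))) (4 * m) (fun t => (w t).toList)
    (tagOffset B)
  have hd : decode (padTo (evalPoly p' n m) (code L)).toList = L := by
    refine decode_padTo (List.cons_ne_nil _ _) ?_
    rw [hp']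
    refine length_adviceStrings_le ?_ hk (by simp) fun t => ?_
    · exact (length_code_qubitStrings_le _).trans
        (Nat.mul_le_mul_left 2 (Nat.mul_le_mul hl hl))
    · have := tagOffset_add_le (B := B) t
      omega
  refine ⟨padTo _ (code L), fun x hx E => ?_⟩
  simp_rw [hS]
  refine prob_parallelCircuit Q A (tagLength_pos n m) hd (fun t => ?_) ?_ E
  · refine (hq _).trans_eq ?_
    rw [← hB]
    simp [Instance.size, hx]
  · rw [List.Vector.toList_length, hp', adviceLength]
    omega

end RelAdvice

end

theorem mainTheorem6 :
    (RelAdvice.FBPP_rpoly = RelAdvice.FBPP_poly ∧ RelAdvice.FBPP_poly = RelAdvice.FP_rpoly) ∧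
      RelAdvice.FBQP_rpoly = RelAdvice.FBQP_poly := by
  have h1 : RelAdvice.FBPP_rpoly = RelAdvice.FBPP_poly :=
    (RelAdvice.withRPoly_subset_withPoly RelAdvice.averageable_randomized).antisymm
      (RelAdvice.withPoly_subset_withRPoly _)
  have h2 : RelAdvice.FBPP_rpoly = RelAdvice.FP_rpoly :=
    RelAdvice.FBPP_rpoly_subset_FP_rpoly.antisymm RelAdvice.FP_rpoly_subset_FBPP_rpoly
  exact ⟨⟨h1, h1.symm.trans h2⟩,
    (RelAdvice.withRPoly_subset_withPoly RelAdvice.averageable_quantum).antisymm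
      (RelAdvice.withPoly_subset_withRPoly _)⟩
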